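/- Let $M$ be a graded monoid, i.e. a monoid with a length function $\ell\colon M\to\mathbb N$ such that $\ell(xy)=\ell(x)+\ell(y)$ and $\ell(x)=0$ only for $x=1_M$, and let $\mathbb K$ be a strong semiring, i.e. a Hausdorff topological semiring in which the product of two summable families is summable. For $k\in\mathbb K$ put $k^*=\sum_{n\ge 0}k^n$; $k$ is starrable if this family is summable. Series, i.e. maps $M\to\mathbb K$, carry the topology of pointwise convergence and the Cauchy product, and $s^*=\sum_{n\ge 0}s^n$. Expressions over $M$ with weights in $\mathbb K$ are given by $\mathsf E\to \mathsf 0\mid \mathsf 1\mid m\mid k\mathsf E\mid \mathsf E k\mid \mathsf E+\mathsf E\mid \mathsf E\cdot\mathsf E\mid \mathsf E^*$ with $m\in M\setminus\{1_M\}$, $k\in\mathbb K$ (equality of expressions is syntactic). The constant term $c(\mathsf E)$ is computed inductively by $c(\mathsf 0)=0$, $c(\mathsf 1)=1$, $c(m)=0$, $c(k\mathsf F)=k\,c(\mathsf F)$, $c(\mathsf Fk)=c(\mathsf F)k$, $c(\mathsf F+\mathsf G)=c(\mathsf F)+c(\mathsf G)$, $c(\mathsf F\cdot\mathsf G)=c(\mathsf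 F)c(\mathsf G)$, $c(\mathsf F^*)=c(\mathsf F)^*$; $\mathsf E$ is valid if $c(\mathsf F)$ is starrable for every subexpression $\mathsf F^*$ of $\mathsf E$. The denoted series $|\mathsf E|$ is defined by the obvious induction. A finite automaton $\mathcal A=\langle I,E,T\rangle$ of dimension $Q$ (a finite set) consists of $I,T\in\mathbb K^Q$ and a $Q\times Q$ matrix $E$ of finite $\mathbb K$-linear combinations of elements of $M\setminus\{1_M\}$; it realises the series $I\cdot E^*\cdot T$. A morphism from $\mathcal A$ onto $\mathcal B=\langle J,F,U\rangle$ of dimension $R$ is a surjection $\varphi\colon Q\to R$ whose $0$-$1$ matrix $X_\varphi$ satisfies $IX_\varphi=J$, $EX_\varphi=X_\varphi F$, $T=X_\varphi U$; then $\mathcal B$ is a quotient of $\mathcal A$. Let $Y_\varphi$ be obtained from the transpose of $X_\varphi$ by keeping exactly one $1$ in each row, and $\varphi(\mathcal A)=\langle IX_\varphi,\,Y_\varphi EX_\varphi,\,Y_\varphi T\rangle$. If $\varphi$ is a morphism from $\mathcal A$ onto some automaton, then this automaton is $\varphi(\mathcal A)$, whatever the choice of $Y_\varphi$. An automaton is standard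 if it has a single initial state, with initial weight $1$, which is the end of no transition. Write $$[J,F,c,U]=\Big\langle (1\;\;0),\ \begin{pmatrix}0&J\\0&F\end{pmatrix},\ \begin{pmatrix}c\\U\end{pmatrix}\Big\rangle .$$ For $\mathcal A=[J,F,c,U]$ and $\mathcal B=[K,G,d,V]$ put $k\mathcal A=[kJ,F,kc,U]$, $\mathcal Ak=[J,F,ck,Uk]$, $\mathcal A^*=[c^*J,\ U c^*J+F,\ c^*,\ Uc^*]$, $$\mathcal A+\mathcal B=\Big[(J\;\;K),\begin{pmatrix}F&0\\0&G\end{pmatrix},c+d,\begin{pmatrix}U\\V\end{pmatrix}\Big],\qquad \mathcal A\cdot\mathcal B=\Big[(J\;\;cK),\begin{pmatrix}F&UK\\0&G\end{pmatrix},cd,\begin{pmatrix}Ud\\V\end{pmatrix}\Big].$$ The standard (position) automaton $\mathcal S_{\mathsf E}$ is defined by induction from $\mathcal S_{\mathsf 0}=\langle(1),(0),(0)\rangle$, $\mathcal S_{\mathsf 1}=\langle(1),(0),(1)\rangle$, $\mathcal S_m=[(m),(0),0,(1)]$ by applying these operations. The set $D(\mathsf E)$ of derived terms is defined by $D(\mathsf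 0)=D(\mathsf 1)=\emptyset$, $D(m)=\{\mathsf 1\}$, $D(k\mathsf F)=D(\mathsf F)$, $D(\mathsf Fk)=\{\mathsf Hk:\mathsf H\in D(\mathsf F)\}$, $D(\mathsf F+\mathsf G)=D(\mathsf F)\cup D(\mathsf G)$, $D(\mathsf F\cdot\mathsf G)=\{\mathsf H\cdot\mathsf G:\mathsf H\in D(\mathsf F)\}\cup D(\mathsf G)$, $D(\mathsf F^*)=\{\mathsf H\cdot\mathsf F^*:\mathsf H\in D(\mathsf F)\}$. The standard derived-term automaton $\mathcal T_{\mathsf E}$, whose states are an initial state and the elements of $D(\mathsf E)$, is defined by induction: $\mathcal T_{\mathsf E}=\mathcal S_{\mathsf E}$ if $\mathsf E$ is $\mathsf 0$, $\mathsf 1$ or an atom $m$; $\mathcal T_{k\mathsf F}=k\mathcal T_{\mathsf F}$, and, up to the renaming of the states, $\mathcal T_{\mathsf Fk}=\mathcal T_{\mathsf F}k$ and $\mathcal T_{\mathsf F^*}=(\mathcal T_{\mathsf F})^*$; finally $\mathcal T_{\mathsf F+\mathsf G}=\varphi(\mathcal T_{\mathsf F}+\mathcal T_{\mathsf G})$ and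 $\mathcal T_{\mathsf F\cdot\mathsf G}=\psi(\mathcal T_{\mathsf F}\cdot\mathcal T_{\mathsf G})$, where $\varphi\colon D(\mathsf F)\sqcup D(\mathsf G)\to D(\mathsf F+\mathsf G)$ and $\psi\colon D(\mathsf F)\sqcup D(\mathsf G)\to D(\mathsf F\cdot\mathsf G)$ are the natural maps ($\psi$ sends $\mathsf H\in D(\mathsf F)$ to $\mathsf H\cdot\mathsf G$), extended to the initial state. **Theorem.** Let $\mathsf E$ be a valid expression over $M$ with weights in $\mathbb K$. The construction of $\mathcal T_{\mathsf E}$ makes sense: if $\mathsf E=\mathsf F+\mathsf G$, then $\varphi$ is a morphism from $\mathcal T_{\mathsf F}+\mathcal T_{\mathsf G}$ onto $\mathcal T_{\mathsf E}$, and if $\mathsf E=\mathsf F\cdot\mathsf G$, then $\psi$ is a morphism from $\mathcal T_{\mathsf F}\cdot\mathcal T_{\mathsf G}$ onto $\mathcal T_{\mathsf E}$. The automaton $\mathcal T_{\mathsf E}$ is standard. The series $|\mathsf E|$ is defined (all products and stars in its definition exist), $\mathcal T_{\mathsf E}$ realises $|\mathsf E|$, and $\mathcal T_{\mathsf E}$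 is a quotient of $\mathcal S_{\mathsf E}$. -/

import Mathlib

open scoped BigOperators

noncomputable section

namespace WRat

universe u v w w'

/-! ## Graded monoids, strong semirings, series -/

/-- A graded monoid: a monoid with an additive length function with values in `ℕ` such that the
identity is the only element of length `0`. -/
def IsGraded (M : Type v) [Monoid M] : Prop :=
  ∃ len : M → ℕ, (∀ x y, len (x * y) = len x + len y) ∧ ∀ x, len x = 0 ↔ x = 1

/-- A topological semiring is strong if the product of two summable families is summable. -/
def IsStrong (K : Type u) [Semiring K] [TopologicalSpace K] : Prop :=
  ∀ (ι κ : Type) (f : ι → K) (g : κ → K), Summable f → Summable g →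
    Summable fun p : ι × κ => f p.1 * g p.2

/-- `k` is starrable if the family of its powers is summable. -/
def Starrable {K : Type u} [Semiring K] [TopologicalSpace K] (k : K) : Prop :=
  Summable fun n : ℕ => k ^ n

/-- The star of `k`, i.e. the sum of all its powers. -/
def kstar {K : Type u} [Semiring K] [TopologicalSpace K] (k : K) : K :=
  ∑' n : ℕ, k ^ n

/-- Formal power series over `M` with coefficients in `K`, with the topology of pointwise
convergence. -/
abbrev Series (K : Type u) (M : Type v) := M → K

namespace Series

variable {K : Type u} {M : Type v} [Semiring K] [Monoid M]

open Classical in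
/-- The series `k m`. -/
def monomial (m : M) (k : K) : Series K M := fun x => if x = m then k else 0

/-- The Cauchy product `(s t)(m) = ∑_{u v = m} s(u) t(v)`. -/
def mul (s t : Series K M) : Series K M :=
  fun m => ∑ᶠ p : {p : M × M // p.1 * p.2 = m}, s p.1.1 * t p.1.2

/-- The sums that define the Cauchy product of `s` and `t` are all finite. -/
def MulDefined (s t : Series K M) : Prop :=
  ∀ m, {p : M × M | p.1 * p.2 = m ∧ s p.1 ≠ 0 ∧ t p.2 ≠ 0}.Finite

/-- Powers for the Cauchy product. -/
def pow (s : Series K M) : ℕ → Series K M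
  | 0 => monomial 1 1
  | n + 1 => mul (pow s n) s

/-- The star of a series, i.e. the sum of all its powers. -/
def star [TopologicalSpace K] (s : Series K M) : Series K M := ∑' n : ℕ, pow s n

/-- All the powers of `s` are defined, and they form a summable family. -/
def StarDefined [TopologicalSpace K] (s : Series K M) : Prop :=
  (∀ n, MulDefined (pow s n) s) ∧ Summable fun n : ℕ => pow s n

end Series

/-! ## Weighted rational expressions -/

/-- Rational expressions over `M` with weights in `K`; the atoms are the elements of `M` other than
the identity. -/
inductive RatExp (K : Type u) (M : Type v) [Monoid M] : Type (max u v)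
  | zero : RatExp K M
  | one : RatExp K M
  | atom (m : M) (hm : m ≠ 1) : RatExp K M
  | lmul (k : K) (E : RatExp K M) : RatExp K M
  | rmul (E : RatExp K M) (k : K) : RatExp K M
  | add (E F : RatExp K M) : RatExp K M
  | mul (E F : RatExp K M) : RatExp K M
  | star (E : RatExp K M) : RatExp K M

namespace RatExp

variable {K : Type u} {M : Type v} [Semiring K] [Monoid M]

/-- The constant term of an expression (meaningful for valid expressions). -/
def constTerm [TopologicalSpace K] : RatExp K M → K
  | zero => 0
  | one => 1
  | atom _ _ => 0
  | lmul k F => k * constTerm F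
  | rmul F k => constTerm F * k
  | add F G => constTerm F + constTerm G
  | mul F G => constTerm F * constTerm G
  | star F => kstar (constTerm F)

/-- An expression is valid if for each of its starred subexpressions `F*` the constant term of `F`
is starrable. -/
def Valid [TopologicalSpace K] : RatExp K M → Prop
  | zero => True
  | one => True
  | atom _ _ => True
  | lmul _ F => Valid F
  | rmul F _ => Valid F
  | add F G => Valid F ∧ Valid G
  | mul F G => Valid F ∧ Valid G
  | star F => Valid F ∧ Starrable (constTerm F)

/-- The series denoted by an expression. -/
def series [TopologicalSpace K] : RatExp K M → Series K M
  | zero => fun _ => 0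
  | one => Series.monomial 1 1
  | atom m _ => Series.monomial m 1
  | lmul k F => fun x => k * series F x
  | rmul F k => fun x => series F x * k
  | add F G => fun x => series F x + series G x
  | mul F G => Series.mul (series F) (series G)
  | star F => Series.star (series F)

/-- All the products and stars of series in the definition of the series denoted by an expression
are defined. -/
def SeriesDefined [TopologicalSpace K] : RatExp K M → Prop
  | zero => True
  | one => True
  | atom _ _ => True
  | lmul _ F => SeriesDefined F
  | rmul F _ => SeriesDefined F
  | add F G => SeriesDefined F ∧ SeriesDefined G
  | mul F G => SeriesDefined F ∧ SeriesDefined G ∧ Series.MulDefined (series F) (series G)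
  | star F => SeriesDefined F ∧ Series.StarDefined (series F)

end RatExp

/-! ## Finite automata, conjugacy, morphisms -/

/-- A `K`-automaton over `M` of finite dimension `Q`: an initial row vector `I`, a transition
matrix `E` whose entries are finite linear combinations of elements of `M` other than the identity,
and a final column vector `T`. -/
structure Aut (K : Type u) (M : Type v) [Semiring K] [Monoid M] (Q : Type w) where
  I : Q → K
  E : Matrix Q Q (MonoidAlgebra K M)
  T : Q → K
  proper : ∀ p q, (E p q).coeff 1 = 0

namespace Aut

variable {K : Type u} {M : Type v} [Semiring K] [Monoid M] {Q : Type w} {R : Type w'}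
  [Fintype Q] [Fintype R]

open Classical in
/-- `A` realises `s`, i.e. `s` is the behaviour `I · E* · T` of `A`: every entry of
`E* = ∑ₙ Eⁿ` is a well-defined series, and `s = ∑_{p,q} I(p) E*(p,q) T(q)`. -/
def Realises [TopologicalSpace K] (A : Aut K M Q) (s : Series K M) : Prop :=
  ∃ S : Q → Q → Series K M,
    (∀ p q, HasSum (fun n : ℕ => ((fun m => ((A.E ^ n) p q).coeff m) : Series K M)) (S p q)) ∧
    s = fun m => ∑ p, ∑ q, A.I p * S p q m * A.T q

/-- `A` is standard with initial state `i`: `i` is the only initial state, its initial weight is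
`1`, and it is the end of no transition. -/
def IsStandard (A : Aut K M Q) (i : Q) : Prop :=
  A.I i = 1 ∧ (∀ p, p ≠ i → A.I p = 0) ∧ ∀ p, A.E p i = 0

/-- `A` is conjugate to `B` by the `K`-matrix `X`: `I X = J`, `E X = X F` and `T = X U`. -/
def ConjBy (A : Aut K M Q) (B : Aut K M R) (X : Matrix Q R K) : Prop :=
  Matrix.vecMul A.I X = B.I ∧
  A.E * X.map (MonoidAlgebra.single (1 : M)) = X.map (MonoidAlgebra.single (1 : M)) * B.E ∧
  A.T = Matrix.mulVec X B.T

open Classical in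
/-- The amalgamation matrix of a map. -/
def amalgamation (K : Type u) [Semiring K] {Q : Type w} {R : Type w'} (φ : Q → R) :
    Matrix Q R K :=
  Matrix.of fun q r => if φ q = r then 1 else 0

/-- `φ` is a morphism from `A` onto `B`. -/
def IsMorphism (A : Aut K M Q) (B : Aut K M R) (φ : Q → R) : Prop :=
  Function.Surjective φ ∧ A.ConjBy B (amalgamation K φ)

/-- `B` is a quotient of `A`. -/
def IsQuotient (B : Aut K M R) (A : Aut K M Q) : Prop :=
  ∃ φ : Q → R, IsMorphism A B φ

end Aut

/-! ## Standard automata and the rational operations on them -/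

/-- The blocks of a standard automaton of dimension `Q`
`⟨(1 0), (0 J; 0 F), (c; U)⟩`, whose set of states is `Q` with an initial state added. -/
structure StdAut (K : Type u) (M : Type v) [Semiring K] [Monoid M] (Q : Type w) where
  J : Q → MonoidAlgebra K M
  F : Matrix Q Q (MonoidAlgebra K M)
  c : K
  U : Q → K
  J_proper : ∀ q, (J q).coeff 1 = 0
  F_proper : ∀ p q, (F p q).coeff 1 = 0

namespace StdAut

variable {K : Type u} {M : Type v} [Semiring K] [Monoid M] {Q : Type w} {R : Type w'}

/-- The automaton with the given blocks; its initial state is `none`. -/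
def toAut (A : StdAut K M Q) : Aut K M (Option Q) where
  I
    | none => 1
    | some _ => 0
  E := Matrix.of fun
    | none, some q => A.J q
    | some p, some q => A.F p q
    | _, none => 0
  T
    | none => A.c
    | some q => A.U q
  proper := by
    rintro (_ | p) (_ | q) <;> simp [A.J_proper, A.F_proper]

/-- `⟨(1), (0), (c)⟩`, of dimension `∅`. -/
def const (Q : Type w) [IsEmpty Q] (c : K) : StdAut K M Q where
  J := isEmptyElim
  F := Matrix.of isEmptyElim
  c := c
  U := isEmptyElim
  J_proper := isEmptyElim
  F_proper := isEmptyElim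

/-- `⟨(1 0), (0 m; 0 0), (0; 1)⟩`, of dimension a singleton. -/
def letter (Q : Type w) [Unique Q] (m : M) (hm : m ≠ 1) : StdAut K M Q where
  J _ := MonoidAlgebra.single m 1
  F := 0
  c := 0
  U _ := 1
  J_proper _ := by simp [MonoidAlgebra.coeff_single, hm]
  F_proper _ _ := by simp

/-- `k A`. -/
def lmul (k : K) (A : StdAut K M Q) : StdAut K M Q where
  J q := k • A.J q
  F := A.F
  c := k * A.c
  U := A.U
  J_proper q := by simp [A.J_proper]
  F_proper := A.F_proper

/-- `A k`. -/
def rmul (A : StdAut K M Q) (k : K) : StdAut K M Q where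
  J := A.J
  F := A.F
  c := A.c * k
  U q := A.U q * k
  J_proper := A.J_proper
  F_proper := A.F_proper

/-- `A + B`. -/
def add (A : StdAut K M Q) (B : StdAut K M R) : StdAut K M (Q ⊕ R) where
  J := Sum.elim A.J B.J
  F := Matrix.fromBlocks A.F 0 0 B.F
  c := A.c + B.c
  U := Sum.elim A.U B.U
  J_proper := by rintro (p | p) <;> simp [A.J_proper, B.J_proper]
  F_proper := by rintro (p | p) (q | q) <;> simp [A.F_proper, B.F_proper]

/-- `A · B`. -/
def mul (A : StdAut K M Q) (B : StdAut K M R) : StdAut K M (Q ⊕ R) where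
  J := Sum.elim A.J fun r => A.c • B.J r
  F := Matrix.fromBlocks A.F (Matrix.of fun q r => A.U q • B.J r) 0 B.F
  c := A.c * B.c
  U := Sum.elim (fun q => A.U q * B.c) B.U
  J_proper := by rintro (p | p) <;> simp [A.J_proper, B.J_proper]
  F_proper := by rintro (p | p) (q | q) <;> simp [A.F_proper, B.F_proper, B.J_proper]

/-- `A*` (meaningful if the constant term of `A` is starrable). -/
def star [TopologicalSpace K] (A : StdAut K M Q) : StdAut K M Q where
  J q := kstar A.c • A.J q
  F := Matrix.of fun p q => (A.U p * kstar A.c) • A.J q + A.F p q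
  c := kstar A.c
  U q := A.U q * kstar A.c
  J_proper q := by simp [A.J_proper]
  F_proper p q := by simp [A.J_proper, A.F_proper]

/-- Renaming of the states along a bijection. -/
def reindex (e : Q ≃ R) (A : StdAut K M Q) : StdAut K M R where
  J r := A.J (e.symm r)
  F := Matrix.of fun r r' => A.F (e.symm r) (e.symm r')
  c := A.c
  U r := A.U (e.symm r)
  J_proper _ := A.J_proper _
  F_proper _ _ := A.F_proper _ _

open Classical in
/-- The image `φ(A) = ⟨I·X, Y·E·X, Y·T⟩` of a standard automaton under a surjective map `φ` of its
non-initial states, where `X` is the amalgamation matrix of `φ` (extended to the initial state) and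
`Y` the selection matrix that picks a representative in each class of the map equivalence of `φ`.
If `φ` is a morphism then this does not depend on the representatives. -/
def image [Fintype Q] (A : StdAut K M Q) (φ : Q → R) (hφ : Function.Surjective φ) :
    StdAut K M R where
  J r := ∑ q, if φ q = r then A.J q else 0
  F := Matrix.of fun r r' => ∑ q, if φ q = r' then A.F (Function.surjInv hφ r) q else 0
  c := A.c
  U r := A.U (Function.surjInv hφ r)
  J_proper r := by
    rw [MonoidAlgebra.coeff_sum, Finsupp.finsetSum_apply]
    refine Finset.sum_eq_zero fun q _ => ?_
    split_ifs <;> simp [A.J_proper]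
  F_proper r r' := by
    rw [Matrix.of_apply, MonoidAlgebra.coeff_sum, Finsupp.finsetSum_apply]
    refine Finset.sum_eq_zero fun q _ => ?_
    split_ifs <;> simp [A.F_proper]

end StdAut

namespace RatExp

variable {K : Type u} {M : Type v} [Semiring K] [Monoid M]

/-! ## The standard (position) automaton of an expression -/

/-- The set of positions of the atoms of an expression. -/
def Pos : RatExp K M → Type
  | zero => Empty
  | one => Empty
  | atom _ _ => Unit
  | lmul _ F => Pos F
  | rmul F _ => Pos F
  | add F G => Pos F ⊕ Pos G
  | mul F G => Pos F ⊕ Pos G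
  | star F => Pos F

/-- There are finitely many positions. -/
instance instFintypePos : (E : RatExp K M) → Fintype (Pos E)
  | zero => inferInstanceAs (Fintype Empty)
  | one => inferInstanceAs (Fintype Empty)
  | atom _ _ => inferInstanceAs (Fintype Unit)
  | lmul _ F => instFintypePos F
  | rmul F _ => instFintypePos F
  | add F G =>
    letI := instFintypePos F
    letI := instFintypePos G
    inferInstanceAs (Fintype (Pos F ⊕ Pos G))
  | mul F G =>
    letI := instFintypePos F
    letI := instFintypePos G
    inferInstanceAs (Fintype (Pos F ⊕ Pos G))
  | star F => instFintypePos F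

/-- The standard automaton (position automaton) `S_E` of an expression `E`. -/
def stan [TopologicalSpace K] : (E : RatExp K M) → StdAut K M (Pos E)
  | zero => StdAut.const Empty 0
  | one => StdAut.const Empty 1
  | atom m hm => StdAut.letter Unit m hm
  | lmul k F => (stan F).lmul k
  | rmul F k => (stan F).rmul k
  | add F G => (stan F).add (stan G)
  | mul F G => (stan F).mul (stan G)
  | star F => (stan F).star

end RatExp

namespace RatExp

variable {K : Type u} {M : Type v} [Monoid M]

/-! ## Derived terms and the standard derived-term automaton -/

open Classical in
/-- The (finite) set of derived terms of an expression. -/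
def derTer : RatExp K M → Finset (RatExp K M)
  | zero => ∅
  | one => ∅
  | atom _ _ => {one}
  | lmul _ F => derTer F
  | rmul F k => (derTer F).image fun H => rmul H k
  | add F G => derTer F ∪ derTer G
  | mul F G => (derTer F).image (fun H => mul H G) ∪ derTer G
  | star F => (derTer F).image fun H => mul H (star F)

instance instIsEmptyDerTerZero : IsEmpty ↥(derTer (zero : RatExp K M)) :=
  ⟨fun x => Finset.notMem_empty _ x.2⟩

instance instIsEmptyDerTerOne : IsEmpty ↥(derTer (one : RatExp K M)) :=
  ⟨fun x => Finset.notMem_empty _ x.2⟩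

instance instUniqueDerTerAtom (m : M) (hm : m ≠ 1) :
    Unique ↥(derTer (atom m hm : RatExp K M)) where
  default := ⟨one, Finset.mem_singleton_self _⟩
  uniq x := Subtype.ext (Finset.mem_singleton.1 x.2)

/-- The bijection `H ↦ H k` from the derived terms of `F` onto those of `F k`. -/
def derTerRmulEquiv (F : RatExp K M) (k : K) : ↥(derTer F) ≃ ↥(derTer (rmul F k)) :=
  Equiv.ofBijective
    (fun H => ⟨rmul H.1 k, by classical exact Finset.mem_image_of_mem _ H.2⟩) <| by
      classical
      refine ⟨fun H H' h => ?_, fun L => ?_⟩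
      · have h1 := congrArg Subtype.val h
        injection h1 with h2
        exact Subtype.ext h2
      · obtain ⟨H, hH, hL⟩ := Finset.mem_image.1 L.2
        exact ⟨⟨H, hH⟩, Subtype.ext hL⟩

/-- The bijection `H ↦ H · F*` from the derived terms of `F` onto those of `F*`. -/
def derTerStarEquiv (F : RatExp K M) : ↥(derTer F) ≃ ↥(derTer (star F)) :=
  Equiv.ofBijective
    (fun H => ⟨mul H.1 (star F), by classical exact Finset.mem_image_of_mem _ H.2⟩) <| by
      classical
      refine ⟨fun H H' h => ?_, fun L => ?_⟩
      · have h1 := congrArg Subtype.val h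
        injection h1 with h2
        exact Subtype.ext h2
      · obtain ⟨H, hH, hL⟩ := Finset.mem_image.1 L.2
        exact ⟨⟨H, hH⟩, Subtype.ext hL⟩

/-- The natural map from the disjoint union of the sets of derived terms of `F` and `G` onto the
set of derived terms of `F + G`. -/
def addMap (F G : RatExp K M) : ↥(derTer F) ⊕ ↥(derTer G) → ↥(derTer (add F G))
  | Sum.inl H => ⟨H.1, by classical exact Finset.mem_union_left _ H.2⟩
  | Sum.inr H => ⟨H.1, by classical exact Finset.mem_union_right _ H.2⟩

theorem addMap_surjective (F G : RatExp K M) : Function.Surjective (addMap F G) := by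
  classical
  intro L
  rcases Finset.mem_union.1 L.2 with h | h
  · exact ⟨Sum.inl ⟨L.1, h⟩, rfl⟩
  · exact ⟨Sum.inr ⟨L.1, h⟩, rfl⟩

/-- The natural map from the disjoint union of the sets of derived terms of `F`, each multiplied by
`G`, and of `G` onto the set of derived terms of `F · G`. -/
def mulMap (F G : RatExp K M) : ↥(derTer F) ⊕ ↥(derTer G) → ↥(derTer (mul F G))
  | Sum.inl H => ⟨mul H.1 G, by
      classical exact Finset.mem_union_left _ (Finset.mem_image_of_mem _ H.2)⟩
  | Sum.inr H => ⟨H.1, by classical exact Finset.mem_union_right _ H.2⟩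

theorem mulMap_surjective (F G : RatExp K M) : Function.Surjective (mulMap F G) := by
  classical
  intro L
  rcases Finset.mem_union.1 L.2 with h | h
  · obtain ⟨H, hH, hL⟩ := Finset.mem_image.1 h
    exact ⟨Sum.inl ⟨H, hH⟩, Subtype.ext hL⟩
  · exact ⟨Sum.inr ⟨L.1, h⟩, rfl⟩

/-- The standard derived-term automaton `T_E` of an expression `E`, of dimension the set of derived
terms of `E`. -/
def term [Semiring K] [TopologicalSpace K] : (E : RatExp K M) → StdAut K M ↥(derTer E)
  | zero => StdAut.const _ 0
  | one => StdAut.const _ 1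
  | atom m hm => StdAut.letter _ m hm
  | lmul k F => (term F).lmul k
  | rmul F k => ((term F).rmul k).reindex (derTerRmulEquiv F k)
  | add F G => ((term F).add (term G)).image (addMap F G) (addMap_surjective F G)
  | mul F G => ((term F).mul (term G)).image (mulMap F G) (mulMap_surjective F G)
  | star F => (term F).star.reindex (derTerStarEquiv F)

end RatExp

end WRat

end

/-! The inductive construction of `term E` has a closed form. Let `deriv E H` be the coefficient of
the derived term `H` in the differential of `E`, defined by the usual product and star rules. Then
the initial row of `term E` is `deriv E`, the row of a state `H` is `deriv H`, and the final weights
are `constTerm E` and `constTerm H` (`term_isDifferential`). So everything that leaves a state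
depends only on the expression naming it, not on the place where this expression arose. Merging two
states with the same name is therefore a morphism, whichever representative is kept. This rests on
two facts: `deriv E` vanishes outside `derTer E`, and derived terms of derived terms of `E` are
derived terms of `E`.

The quotient statement follows by induction: `stan` and `term` are built by the same operations,
these preserve morphisms, and the mergings and renamings that only `term` performs are morphisms,
with which one composes.

For the series, the heart is the expansion `|E| = c(E) + ∑ H, deriv E H · |H|` (`series_eq`).
Applied to `E` and to all its derived terms, it says that their series solve the linear system of
`term E`. The entries of the matrix have no constant term, so induction on length shows that this
system determines its solution, which is thus the behaviour of the states (`realises_of_system`).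

Two points of analysis remain. An element of `M` may have infinitely many factorizations, so all
computations take place in the submonoid generated by the finitely many atoms of `E`, where
factorizations are finite in number. And the powers of a series `s` with `s 1` starrable are
summable: at a fixed `m` their coefficients satisfy an affine recursion with multiplier `s 1`, whose
inhomogeneous term involves shorter elements only, and strength of the semiring sums it
(`hasSum_recursion`, `summable_pow`). -/

noncomputable section

namespace WRat

universe u v w w' w''

/-! ### Morphisms of standard automata and the rational operations -/

namespace StdAut

variable {K : Type u} {M : Type v} [Semiring K] [Monoid M]
  {Q : Type w} {R : Type w'} {S : Type w''} [Fintype Q] [Fintype R] [Fintype S]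

/-- `φ` commutes with the data of the standard automata `A` and `B`. -/
structure IsMor (A : StdAut K M Q) (B : StdAut K M R) (φ : Q → R) : Prop where
  J_eq : ∀ r, (open Classical in ∑ q, if φ q = r then A.J q else 0) = B.J r
  F_eq : ∀ p r, (open Classical in ∑ q, if φ q = r then A.F p q else 0) = B.F (φ p) r
  c_eq : A.c = B.c
  U_eq : ∀ q, A.U q = B.U (φ q)

omit [Fintype R] in
open Classical in
theorem mul_map_amalgamation_apply {Q' : Type*} (E : Matrix Q' Q (MonoidAlgebra K M)) (φ : Q → R)
    (p : Q') (r : R) :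
    (E * (Aut.amalgamation K φ).map (MonoidAlgebra.single (1 : M))) p r =
      ∑ q, if φ q = r then E p q else 0 := by
  rw [Matrix.mul_apply]
  refine Finset.sum_congr rfl fun q _ => ?_
  simp only [Aut.amalgamation, Matrix.map_apply, Matrix.of_apply]
  split_ifs
  · rw [← MonoidAlgebra.one_def, mul_one]
  · rw [MonoidAlgebra.single_zero, mul_zero]

omit [Fintype Q] in
theorem map_amalgamation_mul_apply {R' : Type*} (F : Matrix R R' (MonoidAlgebra K M)) (φ : Q → R)
    (p : Q) (r : R') :
    ((Aut.amalgamation K φ).map (MonoidAlgebra.single (1 : M)) * F) p r = F (φ p) r := by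
  classical
  rw [Matrix.mul_apply, Finset.sum_eq_single (φ p)]
  · simp [Aut.amalgamation, ← MonoidAlgebra.one_def]
  · intro q _ hq
    simp [Aut.amalgamation, hq.symm]
  · simp

theorem IsMor.isMorphism {A : StdAut K M Q} {B : StdAut K M R} {φ : Q → R} (h : IsMor A B φ)
    (hφ : Function.Surjective φ) : Aut.IsMorphism A.toAut B.toAut (Option.map φ) := by
  classical
  refine ⟨?_, ?_, ?_, ?_⟩
  · rintro (_ | r)
    · exact ⟨none, rfl⟩
    · obtain ⟨q, rfl⟩ := hφ r
      exact ⟨some q, rfl⟩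
  · ext r
    rw [Matrix.vecMul, dotProduct, Fintype.sum_option]
    cases r <;> simp [toAut, Aut.amalgamation]
  · ext1 p r
    rw [mul_map_amalgamation_apply, map_amalgamation_mul_apply, Fintype.sum_option]
    rcases p with _ | p <;> rcases r with _ | r <;> simp [toAut, ← h.J_eq, ← h.F_eq]
  · ext q
    rw [Matrix.mulVec, dotProduct, Finset.sum_eq_single (q.map φ)]
    · cases q <;> simp [toAut, Aut.amalgamation, h.c_eq, h.U_eq]
    · intro r _ hr
      simp [Aut.amalgamation, hr.symm]
    · simp

omit [Fintype S] in
theorem IsMor.comp {A : StdAut K M Q} {B : StdAut K M R} {C : StdAut K M S} {φ : Q → R}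
    {ψ : R → S} (hψ : IsMor B C ψ) (hφ : IsMor A B φ) : IsMor A C (ψ ∘ φ) := by
  classical
  -- The fibre of `ψ ∘ φ` over `s` is the disjoint union of the fibres of `φ` over the points of the
  -- fibre of `ψ`.
  have key : ∀ (f : Q → MonoidAlgebra K M) (s : S),
      (∑ r, if ψ r = s then (∑ q, if φ q = r then f q else 0) else 0) =
        ∑ q, if ψ (φ q) = s then f q else 0 := by
    intro f s
    simp only [← Finset.sum_filter]
    rw [Finset.sum_comm' (t' := Finset.univ.filter fun q => ψ (φ q) = s) (s' := fun q => {φ q})]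
    · simp
    · intro x y
      simp only [Finset.mem_filter, Finset.mem_univ, true_and, Finset.mem_singleton]
      constructor
      · rintro ⟨rfl, rfl⟩; exact ⟨rfl, rfl⟩
      · rintro ⟨rfl, rfl⟩; exact ⟨rfl, rfl⟩
  refine ⟨fun s => ?_, fun p s => ?_, hφ.c_eq.trans hψ.c_eq,
    fun q => (hφ.U_eq q).trans (hψ.U_eq _)⟩
  · rw [← hψ.J_eq]
    refine (key A.J s).symm.trans (Finset.sum_congr rfl fun r _ => ?_)
    rw [← hφ.J_eq]
  · rw [Function.comp_apply, ← hψ.F_eq]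
    refine (key (A.F p) s).symm.trans (Finset.sum_congr rfl fun r _ => ?_)
    rw [← hφ.F_eq]

omit [Fintype R] in
theorem isMor_reindex (A : StdAut K M Q) (e : Q ≃ R) : IsMor A (A.reindex e) e := by
  classical
  have key : ∀ (f : Q → MonoidAlgebra K M) r, (∑ q, if e q = r then f q else 0) = f (e.symm r) := by
    intro f r
    simp only [← Equiv.eq_symm_apply]
    simp
  exact ⟨fun r => key _ r, fun p r => by rw [key]; simp [reindex], rfl, fun q => by simp [reindex]⟩

omit [Fintype R] in
theorem IsMor.lmul {A : StdAut K M Q} {B : StdAut K M R} {φ : Q → R} (h : IsMor A B φ) (k : K) :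
    IsMor (A.lmul k) (B.lmul k) φ := by
  classical
  refine ⟨fun r => ?_, h.F_eq, congrArg (k * ·) h.c_eq, h.U_eq⟩
  simp only [StdAut.lmul, ← h.J_eq, Finset.smul_sum, smul_ite, smul_zero]

omit [Fintype R] in
theorem IsMor.rmul {A : StdAut K M Q} {B : StdAut K M R} {φ : Q → R} (h : IsMor A B φ) (k : K) :
    IsMor (A.rmul k) (B.rmul k) φ :=
  ⟨h.J_eq, h.F_eq, congrArg (· * k) h.c_eq, fun q => congrArg (· * k) (h.U_eq q)⟩

omit [Fintype R] in
-- In the new transitions `U c* J` the left factor is pulled back along `φ` and `J` is summed over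
-- fibres, so the fibre sums pass through the product. The block `U K` of a product of automata
-- behaves in the same way.
theorem IsMor.star [TopologicalSpace K] {A : StdAut K M Q} {B : StdAut K M R} {φ : Q → R}
    (h : IsMor A B φ) : IsMor A.star B.star φ := by
  classical
  refine ⟨fun r => ?_, fun p r => ?_, congrArg kstar h.c_eq, fun q => ?_⟩
  · simp only [StdAut.star, ← h.J_eq, ← h.c_eq, Finset.smul_sum, smul_ite, smul_zero]
  · simp only [StdAut.star, Matrix.of_apply, ← h.J_eq, ← h.F_eq, ← h.c_eq, ← h.U_eq,
      Finset.smul_sum, smul_ite, smul_zero, ← Finset.sum_add_distrib]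
    refine Finset.sum_congr rfl fun q _ => ?_
    split_ifs <;> simp
  · simp only [StdAut.star, h.c_eq, h.U_eq]

omit [Fintype R] in
theorem IsMor.add {Q' R' : Type*} [Fintype Q'] {A : StdAut K M Q} {B : StdAut K M R}
    {A' : StdAut K M Q'} {B' : StdAut K M R'} {φ : Q → R} {φ' : Q' → R'} (h : IsMor A B φ)
    (h' : IsMor A' B' φ') : IsMor (A.add A') (B.add B') (Sum.map φ φ') := by
  classical
  refine ⟨?_, ?_, congrArg₂ (· + ·) h.c_eq h'.c_eq, ?_⟩
  · rintro (r | r) <;> simp [StdAut.add, Fintype.sum_sum_type, ← h.J_eq, ← h'.J_eq]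
  · rintro (p | p) (r | r) <;> simp [StdAut.add, Fintype.sum_sum_type, ← h.F_eq, ← h'.F_eq]
  · rintro (q | q) <;> simp [StdAut.add, h.U_eq, h'.U_eq]

omit [Fintype R] in
theorem IsMor.mul {Q' R' : Type*} [Fintype Q'] {A : StdAut K M Q} {B : StdAut K M R}
    {A' : StdAut K M Q'} {B' : StdAut K M R'} {φ : Q → R} {φ' : Q' → R'} (h : IsMor A B φ)
    (h' : IsMor A' B' φ') : IsMor (A.mul A') (B.mul B') (Sum.map φ φ') := by
  classical
  refine ⟨?_, ?_, congrArg₂ (· * ·) h.c_eq h'.c_eq, ?_⟩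
  · rintro (r | r) <;>
      simp [StdAut.mul, Fintype.sum_sum_type, ← h.J_eq, ← h'.J_eq, h.c_eq, Finset.smul_sum]
  · rintro (p | p) (r | r) <;>
      simp [StdAut.mul, Fintype.sum_sum_type, ← h.F_eq, ← h'.F_eq, ← h'.J_eq, h.U_eq,
        Finset.smul_sum]
  · rintro (q | q) <;> simp [StdAut.mul, h.U_eq, h'.U_eq, h'.c_eq]

omit [Fintype Q] in
theorem toAut_isStandard (A : StdAut K M Q) : A.toAut.IsStandard none :=
  ⟨rfl, by rintro (_ | p) hp <;> [exact absurd rfl hp; rfl], by rintro (_ | p) <;> rfl⟩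

end StdAut

/-! ### Differentials of expressions and the merging of states -/

namespace RatExp

variable {K : Type u} {M : Type v} [Semiring K] [Monoid M] [TopologicalSpace K]

open Classical in
/-- The coefficient of a derived term in the differential of an expression. -/
def deriv : RatExp K M → RatExp K M → MonoidAlgebra K M
  | zero, _ => 0
  | one, _ => 0
  | atom m _, L => if L = one then MonoidAlgebra.single m 1 else 0
  | lmul k F, L => k • deriv F L
  | rmul F k, L => ∑ H ∈ derTer F, if rmul H k = L then deriv F H else 0
  | add F G, L => deriv F L + deriv G L
  | mul F G, L =>
    (∑ H ∈ derTer F, if mul H G = L then deriv F H else 0) + constTerm F • deriv G L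
  | star F, L =>
    kstar (constTerm F) • ∑ H ∈ derTer F, if mul H (star F) = L then deriv F H else 0

omit [Semiring K] [TopologicalSpace K] in
-- This transitivity ensures that the differential of a state `H` involves only states of the
-- automaton of `E`.
theorem derTer_subset {E H : RatExp K M} (h : H ∈ derTer E) : derTer H ⊆ derTer E := by
  classical
  induction E generalizing H with
  | zero => simp [derTer] at h
  | one => simp [derTer] at h
  | atom m hm =>
    obtain rfl := Finset.mem_singleton.1 h
    simp [derTer]
  | lmul k F ih => exact ih h
  | rmul F k ih =>
    obtain ⟨H, hH, rfl⟩ := Finset.mem_image.1 h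
    simpa [derTer] using Finset.image_subset_image (ih hH)
  | add F G ihF ihG =>
    rcases Finset.mem_union.1 h with h | h
    · exact (ihF h).trans Finset.subset_union_left
    · exact (ihG h).trans Finset.subset_union_right
  | mul F G ihF ihG =>
    rcases Finset.mem_union.1 h with h | h
    · obtain ⟨H, hH, rfl⟩ := Finset.mem_image.1 h
      exact Finset.union_subset_union (by convert Finset.image_subset_image (ihF hH))
        (Finset.Subset.refl _)
    · exact (ihG h).trans Finset.subset_union_right
  | star F ih =>
    obtain ⟨H, hH, rfl⟩ := Finset.mem_image.1 h
    refine Finset.union_subset (Finset.Subset.trans ?_ (Finset.image_subset_image (ih hH)))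
      (Finset.Subset.refl _)
    intro L hL
    convert hL

/-- Thanks to this, sums against `deriv E` may range over any finite set that contains `derTer E`.
-/
theorem deriv_eq_zero {E L : RatExp K M} (h : L ∉ derTer E) : deriv E L = 0 := by
  classical
  induction E generalizing L with
  | zero => rfl
  | one => rfl
  | atom m hm =>
    rw [deriv, if_neg]
    exact fun hL => h (Finset.mem_singleton.2 hL)
  | lmul k F ih => rw [deriv, ih h, smul_zero]
  | rmul F k ih =>
    rw [deriv]
    refine Finset.sum_eq_zero fun H hH => if_neg ?_
    rintro rfl
    exact h (Finset.mem_image_of_mem _ hH)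
  | add F G ihF ihG =>
    rw [deriv, ihF fun hL => h (Finset.mem_union_left _ hL),
      ihG fun hL => h (Finset.mem_union_right _ hL), add_zero]
  | mul F G ihF ihG =>
    rw [deriv, ihG fun hL => h (Finset.mem_union_right _ hL), smul_zero, add_zero]
    refine Finset.sum_eq_zero fun H hH => if_neg ?_
    rintro rfl
    exact h (Finset.mem_union_left _ (Finset.mem_image_of_mem _ hH))
  | star F ih =>
    rw [deriv, Finset.sum_eq_zero, smul_zero]
    refine fun H hH => if_neg ?_
    rintro rfl
    exact h (Finset.mem_image_of_mem _ hH)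

/-- The blocks of `A` are given by the differentials and constant terms of the derived terms. -/
structure IsDifferential (E : RatExp K M) (A : StdAut K M ↥(derTer E)) : Prop where
  J_eq : ∀ H, A.J H = deriv E H.1
  F_eq : ∀ H H', A.F H H' = deriv H.1 H'.1
  c_eq : A.c = constTerm E
  U_eq : ∀ H, A.U H = constTerm H.1

open Classical in
theorem sum_ite_deriv {ι : Type*} [DecidableEq ι] {E H : RatExp K M} (hH : derTer H ⊆ derTer E)
    (f : RatExp K M → ι) (x : ι) :
    (∑ L : ↥(derTer E), if f L.1 = x then deriv H L.1 else 0) =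
      ∑ L ∈ derTer H, if f L = x then deriv H L else 0 := by
  rw [Finset.sum_coe_sort (derTer E) (fun L => if f L = x then deriv H L else 0)]
  refine (Finset.sum_subset hH fun L _ hL => ?_).symm
  rw [deriv_eq_zero hL, ite_self]

open Classical in
theorem sum_ite_eq_deriv {E H : RatExp K M} (hH : derTer H ⊆ derTer E) (x : RatExp K M) :
    (∑ L : ↥(derTer E), if L.1 = x then deriv H L.1 else 0) = deriv H x := by
  rw [sum_ite_deriv hH (fun L => L) x, Finset.sum_ite_eq']
  split_ifs with h
  · rfl
  · rw [deriv_eq_zero h]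

section merge

variable {F G : RatExp K M} {A : StdAut K M ↥(derTer F)} {B : StdAut K M ↥(derTer G)}

open Classical in
theorem IsDifferential.add_J (hA : IsDifferential F A) (hB : IsDifferential G B)
    (r : ↥(derTer (add F G))) :
    (∑ q, if addMap F G q = r then (A.add B).J q else 0) = deriv (add F G) r.1 := by
  rw [Fintype.sum_sum_type]
  simp only [addMap, StdAut.add, Sum.elim_inl, Sum.elim_inr, hA.J_eq, hB.J_eq, Subtype.ext_iff]
  rw [sum_ite_eq_deriv (Finset.Subset.refl _), sum_ite_eq_deriv (Finset.Subset.refl _), deriv]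

open Classical in
-- The right-hand side sees `p` only through the expression `addMap F G p`. Hence states identified
-- by `addMap` have equal rows after summation over classes, which is the morphism condition.
theorem IsDifferential.add_F (hA : IsDifferential F A) (hB : IsDifferential G B)
    (p : ↥(derTer F) ⊕ ↥(derTer G)) (r : ↥(derTer (add F G))) :
    (∑ q, if addMap F G q = r then (A.add B).F p q else 0) = deriv (addMap F G p).1 r.1 := by
  rw [Fintype.sum_sum_type]
  rcases p with p | p
  · simpa [addMap, StdAut.add, hA.F_eq, Subtype.ext_iff] using
      sum_ite_eq_deriv (derTer_subset p.2) r.1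
  · simpa [addMap, StdAut.add, hB.F_eq, Subtype.ext_iff] using
      sum_ite_eq_deriv (derTer_subset p.2) r.1

theorem IsDifferential.add_U (hA : IsDifferential F A) (hB : IsDifferential G B)
    (p : ↥(derTer F) ⊕ ↥(derTer G)) : (A.add B).U p = constTerm (addMap F G p).1 := by
  rcases p with p | p <;> simp [addMap, StdAut.add, hA.U_eq, hB.U_eq]

theorem IsDifferential.add (hA : IsDifferential F A) (hB : IsDifferential G B) :
    IsDifferential (add F G) ((A.add B).image (addMap F G) (addMap_surjective F G)) := by
  refine ⟨fun H => ?_, fun H H' => ?_, ?_, fun H => ?_⟩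
  · rw [← hA.add_J hB]
    simp only [StdAut.image]
    congr!
  -- The row of the chosen representative depends only on its image, which is `H`.
  · refine Eq.trans ?_ ((hA.add_F hB _ _).trans
      (congrArg (fun L : ↥(derTer (.add F G)) => deriv L.1 H'.1)
        (Function.surjInv_eq (addMap_surjective F G) H)))
    simp only [StdAut.image, Matrix.of_apply]
    congr!
  · exact congrArg₂ (· + ·) hA.c_eq hB.c_eq
  · exact (hA.add_U hB _).trans
      (congrArg (fun L : ↥(derTer (.add F G)) => constTerm L.1)
        (Function.surjInv_eq (addMap_surjective F G) H))

theorem IsDifferential.isMor_add (hA : IsDifferential F A) (hB : IsDifferential G B) :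
    StdAut.IsMor (A.add B) ((A.add B).image (addMap F G) (addMap_surjective F G))
      (addMap F G) := by
  refine ⟨fun r => rfl, fun p r => ?_, rfl, fun p => ?_⟩
  · rw [(hA.add hB).F_eq, ← hA.add_F hB]
    congr!
  · rw [hA.add_U hB, (hA.add hB).U_eq]

open Classical in
theorem IsDifferential.mul_J (hA : IsDifferential F A) (hB : IsDifferential G B)
    (r : ↥(derTer (mul F G))) :
    (∑ q, if mulMap F G q = r then (A.mul B).J q else 0) = deriv (mul F G) r.1 := by
  rw [Fintype.sum_sum_type]
  simp only [mulMap, StdAut.mul, Sum.elim_inl, Sum.elim_inr, hA.J_eq, hB.J_eq, hA.c_eq,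
    Subtype.ext_iff]
  rw [sum_ite_deriv (Finset.Subset.refl _) (fun H => mul H G), deriv,
    ← sum_ite_eq_deriv (Finset.Subset.refl (derTer G)), Finset.smul_sum]
  simp only [smul_ite, smul_zero]

open Classical in
-- From `H · G` one either moves inside `H`, or leaves `H` with weight `constTerm H` and enters `G`.
-- The second possibility is the block `U K`, so the entries reproduce the product rule for `deriv`.
theorem IsDifferential.mul_F (hA : IsDifferential F A) (hB : IsDifferential G B)
    (p : ↥(derTer F) ⊕ ↥(derTer G)) (r : ↥(derTer (mul F G))) :
    (∑ q, if mulMap F G q = r then (A.mul B).F p q else 0) = deriv (mulMap F G p).1 r.1 := by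
  rw [Fintype.sum_sum_type]
  rcases p with p | p
  · simp only [mulMap, StdAut.mul, Matrix.fromBlocks_apply₁₁, Matrix.fromBlocks_apply₁₂,
      Matrix.of_apply, hA.F_eq, hA.U_eq, hB.J_eq, Subtype.ext_iff]
    rw [sum_ite_deriv (derTer_subset p.2) (fun H => mul H G), deriv,
      ← sum_ite_eq_deriv (Finset.Subset.refl (derTer G)), Finset.smul_sum]
    simp only [smul_ite, smul_zero]
  · simpa [mulMap, StdAut.mul, hB.F_eq, Subtype.ext_iff] using
      sum_ite_eq_deriv (derTer_subset p.2) r.1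

theorem IsDifferential.mul_U (hA : IsDifferential F A) (hB : IsDifferential G B)
    (p : ↥(derTer F) ⊕ ↥(derTer G)) : (A.mul B).U p = constTerm (mulMap F G p).1 := by
  rcases p with p | p <;> simp [mulMap, StdAut.mul, hA.U_eq, hB.U_eq, hB.c_eq, constTerm]

theorem IsDifferential.mul (hA : IsDifferential F A) (hB : IsDifferential G B) :
    IsDifferential (mul F G) ((A.mul B).image (mulMap F G) (mulMap_surjective F G)) := by
  refine ⟨fun H => ?_, fun H H' => ?_, ?_, fun H => ?_⟩
  · rw [← hA.mul_J hB]
    simp only [StdAut.image]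
    congr!
  · refine Eq.trans ?_ ((hA.mul_F hB _ _).trans
      (congrArg (fun L : ↥(derTer (.mul F G)) => deriv L.1 H'.1)
        (Function.surjInv_eq (mulMap_surjective F G) H)))
    simp only [StdAut.image, Matrix.of_apply]
    congr!
  · exact congrArg₂ (· * ·) hA.c_eq hB.c_eq
  · exact (hA.mul_U hB _).trans
      (congrArg (fun L : ↥(derTer (.mul F G)) => constTerm L.1)
        (Function.surjInv_eq (mulMap_surjective F G) H))

theorem IsDifferential.isMor_mul (hA : IsDifferential F A) (hB : IsDifferential G B) :
    StdAut.IsMor (A.mul B) ((A.mul B).image (mulMap F G) (mulMap_surjective F G))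
      (mulMap F G) := by
  refine ⟨fun r => rfl, fun p r => ?_, rfl, fun p => ?_⟩
  · rw [(hA.mul hB).F_eq, ← hA.mul_F hB]
    congr!
  · rw [hA.mul_U hB, (hA.mul hB).U_eq]

end merge

theorem deriv_rmul_rmul (F : RatExp K M) (k : K) (H : RatExp K M) :
    deriv (rmul F k) (rmul H k) = deriv F H := by
  classical
  simp only [deriv, rmul.injEq, and_true, Finset.sum_ite_eq']
  split_ifs with h
  · rfl
  · rw [deriv_eq_zero h]

/-- Syntactic right multiplication by `G` is injective, so only `L = H` contributes. If `H` is not a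
derived term of `F`, both sides are zero. -/
theorem sum_ite_mul_eq_mul (F G H : RatExp K M) :
    (open Classical in ∑ L ∈ derTer F, if mul L G = mul H G then deriv F L else 0) =
      deriv F H := by
  classical
  simp only [mul.injEq, and_true, Finset.sum_ite_eq']
  split_ifs with h
  · rfl
  · rw [deriv_eq_zero h]

/-- This closed form is what both the merging and the realisation of the series rely on. -/
theorem term_isDifferential (E : RatExp K M) : IsDifferential E (term E) := by
  classical
  induction E with
  | zero => exact ⟨isEmptyElim, isEmptyElim, rfl, isEmptyElim⟩
  | one => exact ⟨isEmptyElim, isEmptyElim, rfl, isEmptyElim⟩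
  | atom m hm =>
    have h1 : ∀ H : ↥(derTer (atom m hm : RatExp K M)), H.1 = one :=
      fun H => Finset.mem_singleton.1 H.2
    exact ⟨fun H => (if_pos (h1 H)).symm, fun H H' => by rw [h1 H]; rfl, rfl,
      fun H => by rw [h1 H]; rfl⟩
  | lmul k F ih =>
    exact ⟨fun H => congrArg (k • ·) (ih.J_eq H), ih.F_eq, congrArg (k * ·) ih.c_eq, ih.U_eq⟩
  | rmul F k ih =>
    have key : ∀ H, ∃ L, derTerRmulEquiv F k L = H := (derTerRmulEquiv F k).surjective
    refine ⟨fun H => ?_, fun H H' => ?_, congrArg (· * k) ih.c_eq, fun H => ?_⟩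
    · obtain ⟨L, rfl⟩ := key H
      simpa [term, StdAut.reindex, StdAut.rmul, ih.J_eq] using! (deriv_rmul_rmul F k L).symm
    · obtain ⟨L, rfl⟩ := key H
      obtain ⟨L', rfl⟩ := key H'
      simpa [term, StdAut.reindex, StdAut.rmul, ih.F_eq] using! (deriv_rmul_rmul L.1 k L').symm
    · obtain ⟨L, rfl⟩ := key H
      simp [term, StdAut.reindex, StdAut.rmul, ih.U_eq]
      rfl
  | add F G ihF ihG => exact ihF.add ihG
  | mul F G ihF ihG => exact ihF.mul ihG
  | star F ih =>
    have key : ∀ H, ∃ L, derTerStarEquiv F L = H := (derTerStarEquiv F).surjective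
    have hJ : ∀ L : ↥(derTer F), deriv (star F) (derTerStarEquiv F L).1 =
        kstar (constTerm F) • deriv F L.1 :=
      fun L => congrArg (kstar (constTerm F) • ·) (sum_ite_mul_eq_mul F (star F) L.1)
    refine ⟨fun H => ?_, fun H H' => ?_, congrArg kstar ih.c_eq, fun H => ?_⟩
    · obtain ⟨L, rfl⟩ := key H
      simp [term, StdAut.reindex, StdAut.star, ih.J_eq, ih.c_eq, hJ]
    · obtain ⟨L, rfl⟩ := key H
      obtain ⟨L', rfl⟩ := key H'
      -- This is the product rule for `L · F*`. With `hJ` it becomes the entry `F + U c* J` of the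
      -- starred automaton.
      have h1 : deriv (derTerStarEquiv F L).1 (derTerStarEquiv F L').1 =
          deriv L.1 L'.1 + constTerm L.1 • deriv (star F) (derTerStarEquiv F L').1 :=
        congrArg (· + _) (sum_ite_mul_eq_mul L.1 (star F) L'.1)
      rw [h1, hJ]
      simp [term, StdAut.reindex, StdAut.star, ih.J_eq, ih.F_eq, ih.c_eq, ih.U_eq, add_comm,
        mul_smul]
    · obtain ⟨L, rfl⟩ := key H
      simp [term, StdAut.reindex, StdAut.star, ih.U_eq, ih.c_eq]
      rfl

/-- At each operation the morphisms of the operands are combined, then composed with the renaming or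
merging that `term` performs. -/
theorem exists_isMor_stan_term (E : RatExp K M) :
    ∃ φ : Pos E → ↥(derTer E), Function.Surjective φ ∧ StdAut.IsMor (stan E) (term E) φ := by
  induction E with
  | zero =>
    exact ⟨Empty.elim, isEmptyElim, isEmptyElim, fun p => p.elim, rfl, fun p => p.elim⟩
  | one =>
    exact ⟨Empty.elim, isEmptyElim, isEmptyElim, fun p => p.elim, rfl, fun p => p.elim⟩
  | atom m hm =>
    exact ⟨fun _ => default, fun r => ⟨(), Subsingleton.elim _ _⟩,
      fun r => (Fintype.sum_unique (ι := Unit) _).trans (if_pos (Subsingleton.elim _ _)),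
      fun p r => (Fintype.sum_unique (ι := Unit) _).trans (if_pos (Subsingleton.elim _ _)),
      rfl, fun _ => rfl⟩
  | lmul k F ih =>
    obtain ⟨φ, hφ, h⟩ := ih
    exact ⟨φ, hφ, h.lmul k⟩
  | rmul F k ih =>
    obtain ⟨φ, hφ, h⟩ := ih
    exact ⟨derTerRmulEquiv F k ∘ φ, (Equiv.surjective _).comp hφ,
      (StdAut.isMor_reindex _ _).comp (h.rmul k)⟩
  | add F G ihF ihG =>
    obtain ⟨φ, hφ, h⟩ := ihF
    obtain ⟨ψ, hψ, h'⟩ := ihG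
    exact ⟨addMap F G ∘ Sum.map φ ψ, (addMap_surjective F G).comp (hφ.sumMap hψ),
      ((term_isDifferential F).isMor_add (term_isDifferential G)).comp (h.add h')⟩
  | mul F G ihF ihG =>
    obtain ⟨φ, hφ, h⟩ := ihF
    obtain ⟨ψ, hψ, h'⟩ := ihG
    exact ⟨mulMap F G ∘ Sum.map φ ψ, (mulMap_surjective F G).comp (hφ.sumMap hψ),
      ((term_isDifferential F).isMor_mul (term_isDifferential G)).comp (h.mul h')⟩
  | star F ih =>
    obtain ⟨φ, hφ, h⟩ := ih
    exact ⟨derTerStarEquiv F ∘ φ, (Equiv.surjective _).comp hφ,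
      (StdAut.isMor_reindex _ _).comp h.star⟩

end RatExp

/-! ## Summable families in strong semirings -/

section Summation

open Filter Topology

/-- Grouping the terms of a summable family along a map with finite fibres. -/
theorem hasSum_of_finite_fibres {α β X : Type*} [AddCommMonoid X] [TopologicalSpace X]
    {f : α → X} {x : X} (hf : HasSum f x) (t : β → Finset α) (π : α → β)
    (ht : ∀ a b, a ∈ t b ↔ π a = b) : HasSum (fun b => ∑ a ∈ t b, f a) x := by
  classical
  have hdisj : ∀ s : Finset β, (s : Set β).PairwiseDisjoint t := by
    intro s b _ b' _ hbb'
    refine Finset.disjoint_left.2 fun a ha ha' => hbb' ?_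
    rw [← (ht a b).1 ha, (ht a b').1 ha']
  -- A partial sum of the grouped family is the partial sum of `f` over a finite union of fibres,
  -- and such unions are eventually above any finite set. So no regularity of the topology is
  -- needed.
  have hlim : Tendsto (fun s : Finset β => s.biUnion t) atTop atTop := by
    refine tendsto_atTop.2 fun r => ?_
    filter_upwards [eventually_ge_atTop (r.image π)] with s hs a ha
    exact Finset.mem_biUnion.2 ⟨π a, hs (Finset.mem_image_of_mem _ ha), (ht _ _).2 rfl⟩
  have hf' : Tendsto (fun s : Finset α => ∑ a ∈ s, f a) atTop (𝓝 x) := by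
    simpa [HasSum] using hf
  have := hf'.comp hlim
  simp only [HasSum, SummationFilter.unconditional_filter]
  refine this.congr fun s => ?_
  exact Finset.sum_biUnion (hdisj s)

variable {K : Type u} [Semiring K] [TopologicalSpace K] [IsTopologicalSemiring K] [T2Space K]

/-- Strength only provides the existence of the sum. Its value is found along finite rectangles, on
which partial sums factor, and limits are unique. -/
theorem IsStrong.hasSum_mul (hK : IsStrong K) {ι κ : Type} {f : ι → K} {g : κ → K} {a b : K}
    (hf : HasSum f a) (hg : HasSum g b) : HasSum (fun p : ι × κ => f p.1 * g p.2) (a * b) := by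
  classical
  obtain ⟨c, hc⟩ := hK ι κ f g hf.summable hg.summable
  suffices c = a * b from this ▸ hc
  have hf' : Tendsto (fun s : Finset ι => ∑ i ∈ s, f i) atTop (𝓝 a) := by
    simpa [HasSum] using hf
  have hg' : Tendsto (fun s : Finset κ => ∑ i ∈ s, g i) atTop (𝓝 b) := by
    simpa [HasSum] using hg
  have hc' : Tendsto (fun s : Finset (ι × κ) => ∑ p ∈ s, f p.1 * g p.2) atTop (𝓝 c) := by
    simpa [HasSum] using hc
  have hlim : Tendsto (fun p : Finset ι × Finset κ => p.1 ×ˢ p.2) (atTop ×ˢ atTop) atTop := by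
    rw [prod_atTop_atTop_eq]
    refine tendsto_atTop.2 fun r => ?_
    filter_upwards [eventually_ge_atTop (r.image Prod.fst, r.image Prod.snd)] with s hs p hp
    exact Finset.mem_product.2 ⟨hs.1 (Finset.mem_image_of_mem _ hp),
      hs.2 (Finset.mem_image_of_mem _ hp)⟩
  refine tendsto_nhds_unique (hc'.comp hlim) ?_
  refine ((hf'.comp tendsto_fst).mul (hg'.comp tendsto_snd)).congr fun p => ?_
  simp only [Function.comp_apply, Finset.sum_mul_sum, Finset.sum_product]

theorem IsStrong.hasSum_antidiagonal (hK : IsStrong K) {f g : ℕ → K} {a b : K}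
    (hf : HasSum f a) (hg : HasSum g b) :
    HasSum (fun n => ∑ p ∈ Finset.HasAntidiagonal.antidiagonal n, f p.1 * g p.2) (a * b) :=
  hasSum_of_finite_fibres (hK.hasSum_mul hf hg) _ (fun p => p.1 + p.2) fun p n => by
    simp

/-- The sum of a sequence that is defined by an affine recursion. -/
theorem IsStrong.hasSum_recursion (hK : IsStrong K) {k : K} (hk : Starrable k) {a b : ℕ → K}
    {B : K} (hb : HasSum b B) (hab : ∀ n, a (n + 1) = k * a n + b n) :
    HasSum a (kstar k * (a 0 + B)) := by
  -- The recursion is solved by `a n = ∑ k ^ i * c j` over `i + j = n`, where `c` is `b` shifted by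
  -- one with the initial value `a 0` in front.
  let c : ℕ → K := fun n => if n = 0 then a 0 else b (n - 1)
  have hc : HasSum c (a 0 + B) := HasSum.zero_add (f := c) hb
  have h : HasSum _ (kstar k * (a 0 + B)) := hK.hasSum_antidiagonal hk.hasSum hc
  suffices ha : ∀ n, a n = ∑ p ∈ Finset.HasAntidiagonal.antidiagonal n, k ^ p.1 * c p.2 by
    simpa only [← ha] using h
  intro n
  induction n with
  | zero => simp [c]
  | succ n ih =>
    rw [hab, ih, Finset.Nat.sum_antidiagonal_succ, Finset.mul_sum, add_comm]
    simp [c, pow_succ', mul_assoc]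

end Summation

/-! ## Series with support in a submonoid with finitely many factorizations -/

/-- Every element has finitely many factorizations in two factors from `N`. -/
def FiniteFact {M : Type v} [Monoid M] (N : Submonoid M) : Prop :=
  ∀ m, {p : M × M | p.1 ∈ N ∧ p.2 ∈ N ∧ p.1 * p.2 = m}.Finite

/-- Removing the first generator from a nontrivial product lowers the length by at least one. -/
theorem finite_setOf_length_le {M : Type v} [Monoid M] {len : M → ℕ}
    (hlen : ∀ x y, len (x * y) = len x + len y) {A : Set M} (hA : A.Finite)
    (hA' : ∀ a ∈ A, len a ≠ 0) (n : ℕ) : {x | x ∈ Submonoid.closure A ∧ len x ≤ n}.Finite := by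
  induction n with
  | zero =>
    refine (Set.finite_singleton (1 : M)).subset ?_
    rintro x ⟨hx, hx'⟩
    induction hx using Submonoid.closure_induction_left with
    | one => rfl
    | mul_left a ha y hy _ =>
      rw [hlen] at hx'
      exact absurd (by omega) (hA' a ha)
  | succ n ih =>
    refine ((Set.finite_singleton (1 : M)).union (Set.Finite.image2 (· * ·) hA ih)).subset ?_
    rintro x ⟨hx, hx'⟩
    induction hx using Submonoid.closure_induction_left with
    | one => exact Or.inl rfl
    | mul_left a ha y hy _ =>
      rw [hlen] at hx'
      have := hA' a ha
      exact Or.inr ⟨a, ha, y, ⟨hy, by omega⟩, rfl⟩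

/-- Both factors of `m` are no longer than `m`, hence range over a finite set. -/
theorem finiteFact_closure {M : Type v} [Monoid M] {len : M → ℕ}
    (hlen : ∀ x y, len (x * y) = len x + len y) {A : Set M} (hA : A.Finite)
    (hA' : ∀ a ∈ A, len a ≠ 0) : FiniteFact (Submonoid.closure A) := by
  intro m
  have h := finite_setOf_length_le hlen hA hA' (len m)
  refine (h.prod h).subset ?_
  rintro ⟨x, y⟩ ⟨hx, hy, rfl⟩
  exact ⟨⟨hx, by simp [hlen]⟩, ⟨hy, by simp [hlen]⟩⟩

namespace Series

variable {K : Type u} {M : Type v} [Semiring K] [Monoid M] {N : Submonoid M}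

/-- The support of `s` is contained in `N`. -/
def SuppIn (N : Submonoid M) (s : Series K M) : Prop := ∀ m, m ∉ N → s m = 0

/-- The factorizations of `m` in `N`. -/
def fact (hN : FiniteFact N) (m : M) : Finset (M × M) := (hN m).toFinset

theorem mem_fact {hN : FiniteFact N} {m : M} {p : M × M} :
    p ∈ fact hN m ↔ p.1 ∈ N ∧ p.2 ∈ N ∧ p.1 * p.2 = m := by
  simp [fact]

theorem fact_eq_empty {hN : FiniteFact N} {m : M} (hm : m ∉ N) : fact hN m = ∅ := by
  refine Finset.eq_empty_of_forall_notMem fun p hp => hm ?_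
  obtain ⟨h1, h2, rfl⟩ := mem_fact.1 hp
  exact mul_mem h1 h2

/-- The Cauchy product restricted to factorizations in `N`. -/
def conv (hN : FiniteFact N) (s t : Series K M) : Series K M :=
  fun m => ∑ p ∈ fact hN m, s p.1 * t p.2

theorem suppIn_conv (hN : FiniteFact N) (s t : Series K M) : SuppIn N (conv hN s t) := by
  intro m hm
  rw [conv, fact_eq_empty hm, Finset.sum_empty]

theorem suppIn_monomial {m : M} (hm : m ∈ N) (k : K) : SuppIn N (monomial m k) :=
  fun _ hx => if_neg fun (h : _ = m) => hx (by rwa [h])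

theorem SuppIn.mulDefined {s t : Series K M} (hN : FiniteFact N) (hs : SuppIn N s)
    (ht : SuppIn N t) : MulDefined s t := by
  refine fun m => (hN m).subset ?_
  rintro p ⟨hp, h1, h2⟩
  exact ⟨by_contra fun h => h1 (hs _ h), by_contra fun h => h2 (ht _ h), hp⟩

theorem SuppIn.mul_eq {s t : Series K M} (hN : FiniteFact N) (hs : SuppIn N s)
    (ht : SuppIn N t) : mul s t = conv hN s t := by
  funext m
  rw [mul, conv]
  refine (finsum_set_coe_eq_finsum_mem (f := fun p : M × M => s p.1 * t p.2)
    {p : M × M | p.1 * p.2 = m}).trans (finsum_mem_eq_sum_of_inter_support_eq _ ?_)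
  ext p
  simp only [Set.mem_inter_iff, Set.mem_ofPred_eq, Function.mem_support, Finset.mem_coe, mem_fact]
  refine and_congr_left fun h => ⟨fun hp => ⟨?_, ?_, hp⟩, fun hp => hp.2.2⟩
  · exact by_contra fun h' => h (by rw [hs _ h', zero_mul])
  · exact by_contra fun h' => h (by rw [ht _ h', mul_zero])

/-- Both sides sum over the factorizations of `m` in three factors from `N`, since `N` is closed
under products. No condition on the supports is involved. -/
theorem conv_assoc (hN : FiniteFact N) (s t r : Series K M) :
    conv hN (conv hN s t) r = conv hN s (conv hN t r) := by
  funext m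
  simp only [conv, Finset.sum_mul, Finset.mul_sum]
  rw [Finset.sum_sigma', Finset.sum_sigma']
  refine Finset.sum_nbij' (fun x => ⟨(x.2.1, x.2.2 * x.1.2), (x.2.2, x.1.2)⟩)
    (fun x => ⟨(x.1.1 * x.2.1, x.2.2), (x.1.1, x.2.1)⟩) ?_ ?_ ?_ ?_ ?_
  · rintro ⟨⟨a, b⟩, ⟨c, d⟩⟩ h
    simp only [Finset.mem_sigma, mem_fact] at h ⊢
    obtain ⟨⟨h1, h2, rfl⟩, h4, h5, rfl⟩ := h
    exact ⟨⟨h4, mul_mem h5 h2, (mul_assoc _ _ _).symm⟩, h5, h2, trivial⟩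
  · rintro ⟨⟨a, b⟩, ⟨c, d⟩⟩ h
    simp only [Finset.mem_sigma, mem_fact] at h ⊢
    obtain ⟨⟨h1, h2, rfl⟩, h4, h5, rfl⟩ := h
    exact ⟨⟨mul_mem h1 h4, h5, mul_assoc _ _ _⟩, h1, h4, trivial⟩
  · rintro ⟨⟨a, b⟩, ⟨c, d⟩⟩ h
    simp only [Finset.mem_sigma, mem_fact] at h ⊢
    obtain ⟨⟨h1, h2, rfl⟩, h4, h5, rfl⟩ := h
    rfl
  · rintro ⟨⟨a, b⟩, ⟨c, d⟩⟩ h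
    simp only [Finset.mem_sigma, mem_fact] at h ⊢
    obtain ⟨⟨h1, h2, rfl⟩, h4, h5, rfl⟩ := h
    rfl
  · intro x _
    exact mul_assoc _ _ _

theorem conv_add_left (hN : FiniteFact N) (s s' t : Series K M) :
    conv hN (s + s') t = conv hN s t + conv hN s' t := by
  funext m
  simp [conv, add_mul, Finset.sum_add_distrib]

theorem conv_zero_left (hN : FiniteFact N) (t : Series K M) : conv hN 0 t = 0 := by
  funext m
  simp [conv]

theorem conv_smul_left (hN : FiniteFact N) (k : K) (s t : Series K M) :
    conv hN (k • s) t = k • conv hN s t := by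
  funext m
  simp [conv, mul_assoc, Finset.mul_sum]

theorem conv_sum_left (hN : FiniteFact N) {ι : Type*} (T : Finset ι) (s : ι → Series K M)
    (t : Series K M) : conv hN (∑ i ∈ T, s i) t = ∑ i ∈ T, conv hN (s i) t := by
  funext m
  simp only [conv, Finset.sum_apply, Finset.sum_mul]
  exact Finset.sum_comm

theorem conv_mul_right (hN : FiniteFact N) (s t : Series K M) (k : K) :
    conv hN s (fun x => t x * k) = fun x => conv hN s t x * k := by
  funext m
  simp [conv, mul_assoc, Finset.sum_mul]

/-- Separating the factorizations with trivial left factor. -/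
theorem conv_apply_eq_add {t : Series K M} (hN : FiniteFact N) (s : Series K M) (ht : SuppIn N t)
    (m : M) : (open Classical in conv hN s t m =
      s 1 * t m + ∑ p ∈ fact hN m, if p.1 = 1 then 0 else s p.1 * t p.2) := by
  classical
  by_cases hm : m ∈ N
  · have h1 : (1, m) ∈ fact hN m := mem_fact.2 ⟨one_mem N, hm, one_mul m⟩
    rw [conv, ← Finset.add_sum_erase _ _ h1, ← Finset.add_sum_erase _ _ h1, if_pos rfl, zero_add]
    congr 1
    refine Finset.sum_congr rfl fun p hp => (if_neg fun h => ?_).symm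
    obtain ⟨hp1, hp2⟩ := Finset.mem_erase.1 hp
    have h3 := (mem_fact.1 hp2).2.2
    rw [h, one_mul] at h3
    exact hp1 (Prod.ext h h3)
  · rw [conv, fact_eq_empty hm, ht m hm]
    simp

theorem conv_monomial_one_left {t : Series K M} (hN : FiniteFact N) (ht : SuppIn N t) (k : K) :
    conv hN (monomial 1 k) t = k • t := by
  classical
  funext m
  rw [conv_apply_eq_add hN _ ht, Finset.sum_eq_zero]
  · simp [monomial]
  · intro p _
    split_ifs with h
    · rfl
    · simp [monomial, h]

theorem conv_monomial_one_right {s : Series K M} (hN : FiniteFact N) (hs : SuppIn N s) :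
    conv hN s (monomial 1 1) = s := by
  classical
  funext m
  by_cases hm : m ∈ N
  · rw [conv, Finset.sum_eq_single (m, 1)]
    · simp [monomial]
    · rintro ⟨a, b⟩ hp hp'
      have hb : b ≠ 1 := by
        rintro rfl
        have := (mem_fact.1 hp).2.2
        simp only [mul_one] at this
        exact hp' (by rw [this])
      simp [monomial, hb]
    · exact fun h => absurd (mem_fact.2 ⟨hm, one_mem N, mul_one m⟩) h
  · rw [hs m hm, suppIn_conv hN _ _ m hm]

theorem coeff_mul_eq_conv (hN : FiniteFact N) {x y : MonoidAlgebra K M}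
    (hx : SuppIn N x.coeff) (hy : SuppIn N y.coeff) :
    ((x * y).coeff : Series K M) = conv hN x.coeff y.coeff := by
  classical
  funext m
  rw [MonoidAlgebra.coeff_mul, Finsupp.sum]
  simp only [Finsupp.sum]
  rw [← Finset.sum_product', ← Finset.sum_filter, conv]
  refine Finset.sum_subset (fun p hp => ?_) fun p hp hp' => ?_
  · simp only [Finset.mem_filter, Finset.mem_product, Finsupp.mem_support_iff] at hp
    exact mem_fact.2 ⟨by_contra fun h => hp.1.1 (hx _ h), by_contra fun h => hp.1.2 (hy _ h), hp.2⟩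
  · simp only [Finset.mem_filter, Finset.mem_product, Finsupp.mem_support_iff, not_and,
      (mem_fact.1 hp).2.2, not_true_eq_false, imp_false, not_not] at hp'
    by_cases h : x.coeff p.1 = 0
    · rw [h, zero_mul]
    · rw [hp' h, mul_zero]

theorem suppIn_pow (hN : FiniteFact N) {s : Series K M} (hs : SuppIn N s) (n : ℕ) :
    SuppIn N (pow s n) := by
  induction n with
  | zero => exact suppIn_monomial (one_mem N) 1
  | succ n ih =>
    rw [pow, ih.mul_eq hN hs]
    exact suppIn_conv hN _ _

/-- The powers are defined by right multiplication. Moving the new factor to the left makes `s 1` a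
left multiplier, as the affine recursion requires. -/
theorem pow_succ_eq_conv (hN : FiniteFact N) {s : Series K M} (hs : SuppIn N s) (n : ℕ) :
    pow s (n + 1) = conv hN s (pow s n) := by
  induction n with
  | zero =>
    change mul (monomial 1 1) s = conv hN s (monomial 1 1)
    rw [(suppIn_monomial (one_mem N) 1).mul_eq hN hs, conv_monomial_one_left hN hs,
      conv_monomial_one_right hN hs, one_smul]
  | succ n ih =>
    rw [pow, (suppIn_pow hN hs _).mul_eq hN hs, ih, conv_assoc,
      ← (suppIn_pow hN hs n).mul_eq hN hs, ← pow, ih]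

theorem suppIn_star [TopologicalSpace K] [T2Space K] (hN : FiniteFact N) {s : Series K M} (hs : SuppIn N s)
    (h : Summable fun n => pow s n) : SuppIn N (star s) := by
  intro m hm
  refine (Pi.hasSum.1 h.hasSum m).unique ?_
  simp only [suppIn_pow hN hs _ m hm]
  exact hasSum_zero

/-! ### Star of a series over a graded monoid -/

section Graded

variable {len : M → ℕ} (hlen : ∀ x y, len (x * y) = len x + len y) (hlen0 : ∀ x, len x = 0 ↔ x = 1)

include hlen hlen0

theorem conv_apply_one (hN : FiniteFact N) (s t : Series K M) : conv hN s t 1 = s 1 * t 1 := by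
  have h : fact hN (1 : M) = {(1, 1)} := by
    ext ⟨a, b⟩
    rw [mem_fact, Finset.mem_singleton, Prod.mk.injEq]
    constructor
    · rintro ⟨_, _, h⟩
      have h1 := hlen a b
      rw [h, (hlen0 1).2 rfl] at h1
      exact ⟨(hlen0 a).1 (by omega), (hlen0 b).1 (by omega)⟩
    · rintro ⟨rfl, rfl⟩
      exact ⟨one_mem N, one_mem N, one_mul 1⟩
  rw [conv, h, Finset.sum_singleton]

theorem length_lt_of_mem_fact {hN : FiniteFact N} {m : M} {p : M × M} (hp : p ∈ fact hN m)
    (h1 : p.1 ≠ 1) : len p.2 < len m := by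
  rw [← (mem_fact.1 hp).2.2, hlen]
  have := mt (hlen0 p.1).1 h1
  omega

variable [TopologicalSpace K] [IsTopologicalSemiring K] [T2Space K]

/-- Induction on the length of `m`: once the factorization with left factor `1` is split off, `pow s
(i + 1) m` is `s 1 * pow s i m` plus terms in coefficients of `pow s i` at shorter elements. -/
theorem summable_pow (hK : IsStrong K) (hN : FiniteFact N) {s : Series K M} (hs : SuppIn N s)
    (h1 : Starrable (s 1)) : Summable fun n => pow s n := by
  classical
  rw [Pi.summable]
  suffices h : ∀ n m, len m < n → Summable fun i => pow s i m from fun m => h _ m (Nat.lt_succ_self _)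
  intro n
  induction n with
  | zero => exact fun m hm => absurd hm (Nat.not_lt_zero _)
  | succ n ih =>
    intro m hm
    have hb : Summable fun i => ∑ p ∈ fact hN m, if p.1 = 1 then 0 else s p.1 * pow s i p.2 := by
      refine summable_sum fun p hp => ?_
      split_ifs with hp1
      · exact summable_zero
      · have := length_lt_of_mem_fact hlen hlen0 hp hp1
        exact (ih p.2 (by omega)).mul_left _
    refine (hK.hasSum_recursion h1 hb.hasSum fun i => ?_).summable
    rw [pow_succ_eq_conv hN hs, conv_apply_eq_add hN s (suppIn_pow hN hs i)]

/-- This is the equation `s* = 1 + s s*` at `m`, with the contribution of `s 1 * star s m` absorbed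
into the factor `kstar (s 1)`. -/
theorem star_apply (hK : IsStrong K) (hN : FiniteFact N) {s : Series K M} (hs : SuppIn N s)
    (h1 : Starrable (s 1)) (m : M) : (open Classical in star s m =
      kstar (s 1) * (monomial 1 1 m +
        ∑ p ∈ fact hN m, if p.1 = 1 then 0 else s p.1 * star s p.2)) := by
  classical
  have hsum := Pi.hasSum.1 (summable_pow hlen hlen0 hK hN hs h1).hasSum
  refine (hsum m).unique (hK.hasSum_recursion h1
    (b := fun i => ∑ p ∈ fact hN m, if p.1 = 1 then 0 else s p.1 * pow s i p.2)
    (hasSum_sum fun p _ => ?_) fun i => ?_)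
  · split_ifs
    · exact hasSum_zero
    · exact (hsum p.2).mul_left _
  · rw [pow_succ_eq_conv hN hs, conv_apply_eq_add hN s (suppIn_pow hN hs i)]

end Graded

end Series

/-! ### Proper linear systems and behaviours -/

namespace Aut

variable {K : Type u} {M : Type v} [Semiring K] [Monoid M] {N : Submonoid M} {Q : Type w}
  [Fintype Q] [TopologicalSpace K] [IsTopologicalSemiring K] [T2Space K] {len : M → ℕ}

open Series

open Classical in
/-- The behaviours of the states of a proper automaton are the only solution of the system of
linear equations given by its transition matrix. -/
theorem realises_of_system (hlen : ∀ x y, len (x * y) = len x + len y)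
    (hlen0 : ∀ x, len x = 0 ↔ x = 1) (hN : FiniteFact N) (A : Aut K M Q)
    (hA : ∀ p q, SuppIn N (A.E p q).coeff) {i : Q} (hi : A.I i = 1)
    (hi' : ∀ p, p ≠ i → A.I p = 0) (β : Q → Series K M)
    (hβ : ∀ p m, β p m = A.T p * monomial 1 1 m + ∑ q, conv hN (A.E p q).coeff (β q) m) :
    A.Realises (β i) := by
  have hpow : ∀ n p q, SuppIn N ((A.E ^ n) p q).coeff := by
    intro n
    induction n with
    | zero =>
      intro p q m hm
      rw [pow_zero, Matrix.one_apply]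
      have : m ≠ 1 := fun h => hm (h ▸ one_mem N)
      split_ifs <;> simp [MonoidAlgebra.one_def, this]
    | succ n ih =>
      intro p q m hm
      rw [pow_succ', Matrix.mul_apply, MonoidAlgebra.coeff_sum, Finsupp.finsetSum_apply]
      refine Finset.sum_eq_zero fun r _ => ?_
      rw [coeff_mul_eq_conv hN (hA p r) (ih r q), suppIn_conv hN _ _ m hm]
  have hsucc : ∀ n p q m, ((A.E ^ (n + 1)) p q).coeff m =
      ∑ r, ∑ x ∈ fact hN m, (A.E p r).coeff x.1 * ((A.E ^ n) r q).coeff x.2 := by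
    intro n p q m
    rw [pow_succ', Matrix.mul_apply, MonoidAlgebra.coeff_sum, Finsupp.finsetSum_apply]
    exact Finset.sum_congr rfl fun r _ =>
      congrFun (coeff_mul_eq_conv hN (hA p r) (hpow n r q)) m
  -- Every transition has positive length, so `n` of them never spell an element shorter than `n`.
  -- Hence the star of the matrix is a finite sum at each `m`.
  have hvanish : ∀ n p q m, len m < n → ((A.E ^ n) p q).coeff m = 0 := by
    intro n
    induction n with
    | zero => exact fun p q m hm => absurd hm (Nat.not_lt_zero _)
    | succ n ih =>
      intro p q m hm
      rw [hsucc]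
      refine Finset.sum_eq_zero fun r _ => Finset.sum_eq_zero fun x hx => ?_
      by_cases h1 : x.1 = 1
      · rw [h1, A.proper, zero_mul]
      · have := length_lt_of_mem_fact hlen hlen0 hx h1
        rw [ih _ _ _ (by omega), mul_zero]
  let S : Q → Q → Series K M := fun p q m =>
    ∑ n ∈ Finset.range (len m + 1), ((A.E ^ n) p q).coeff m
  have hS : ∀ p q m, HasSum (fun n => ((A.E ^ n) p q).coeff m) (S p q m) := fun p q m =>
    hasSum_sum_of_ne_finset_zero fun n hn => hvanish n p q m (by simpa using hn)
  -- This is `E* = 1 + E E*`, read entrywise.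
  have hSrec : ∀ p q m, S p q m = (if p = q then monomial 1 1 m else 0) +
      ∑ r, ∑ x ∈ fact hN m, (A.E p r).coeff x.1 * S r q x.2 := by
    intro p q m
    have h0 : ((A.E ^ 0) p q).coeff m = if p = q then monomial 1 1 m else 0 := by
      rw [pow_zero, Matrix.one_apply]
      split_ifs
      · simp [MonoidAlgebra.one_def, monomial, Finsupp.single_apply, eq_comm (a := m)]
      · simp
    rw [← h0]
    refine (hS p q m).unique (HasSum.zero_add (f := fun n => ((A.E ^ n) p q).coeff m) ?_)
    simp only [hsucc]
    exact hasSum_sum fun r _ => hasSum_sum fun x _ => (hS r q x.2).mul_left _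
  -- Both `β` and `E* T` satisfy the same recursion. Factorizations with left factor `1` contribute
  -- nothing because the entries are proper, so only strictly shorter elements enter.
  have hβS : ∀ n p m, len m < n → β p m = ∑ q, S p q m * A.T q := by
    intro n
    induction n with
    | zero => exact fun p m hm => absurd hm (Nat.not_lt_zero _)
    | succ n ih =>
      intro p m hm
      simp only [hSrec p _ m, add_mul, Finset.sum_add_distrib, Finset.sum_mul]
      rw [hβ]
      congr 1
      · by_cases h : m = 1 <;> simp [monomial, h]
      · rw [Finset.sum_comm]
        refine Finset.sum_congr rfl fun r _ => ?_
        rw [Finset.sum_comm, conv]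
        refine Finset.sum_congr rfl fun x hx => ?_
        by_cases h1 : x.1 = 1
        · simp [h1, A.proper]
        · have := length_lt_of_mem_fact hlen hlen0 hx h1
          rw [ih _ _ (by omega), Finset.mul_sum]
          simp only [mul_assoc]
  refine ⟨S, fun p q => Pi.hasSum.2 (hS p q), ?_⟩
  funext m
  rw [Finset.sum_eq_single i, hβS _ i m (Nat.lt_succ_self _)]
  · simp [hi]
  · intro p _ hp
    simp [hi' p hp]
  · simp

end Aut

/-! ### The series of an expression and its expansion along derived terms -/

namespace RatExp

open Series

variable {K : Type u} {M : Type v} [Semiring K] [Monoid M]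

/-- The set of atoms that occur in an expression. -/
def atoms : RatExp K M → Set M
  | zero => ∅
  | one => ∅
  | atom m _ => {m}
  | lmul _ F => atoms F
  | rmul F _ => atoms F
  | add F G => atoms F ∪ atoms G
  | mul F G => atoms F ∪ atoms G
  | star F => atoms F

omit [Semiring K] in
theorem finite_atoms (E : RatExp K M) : (atoms E).Finite := by
  induction E with
  | zero => exact Set.finite_empty
  | one => exact Set.finite_empty
  | atom m hm => exact Set.finite_singleton m
  | lmul k F ih => exact ih
  | rmul F k ih => exact ih
  | add F G ihF ihG => exact ihF.union ihG
  | mul F G ihF ihG => exact ihF.union ihG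
  | star F ih => exact ih

omit [Semiring K] in
theorem ne_one_of_mem_atoms {E : RatExp K M} {m : M} (hm : m ∈ atoms E) : m ≠ 1 := by
  induction E with
  | zero => exact hm.elim
  | one => exact hm.elim
  | atom x hx =>
    obtain rfl : m = x := hm
    exact hx
  | lmul k F ih => exact ih hm
  | rmul F k ih => exact ih hm
  | add F G ihF ihG => exact hm.elim ihF ihG
  | mul F G ihF ihG => exact hm.elim ihF ihG
  | star F ih => exact ih hm

omit [Semiring K] in
theorem atoms_subset_of_mem_derTer {E H : RatExp K M} (h : H ∈ derTer E) :
    atoms H ⊆ atoms E := by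
  classical
  induction E generalizing H with
  | zero => simp [derTer] at h
  | one => simp [derTer] at h
  | atom m hm =>
    obtain rfl := Finset.mem_singleton.1 h
    exact Set.empty_subset _
  | lmul k F ih => exact ih h
  | rmul F k ih =>
    obtain ⟨H, hH, rfl⟩ := Finset.mem_image.1 h
    exact (ih hH :)
  | add F G ihF ihG =>
    rcases Finset.mem_union.1 h with h | h
    · exact (ihF h).trans Set.subset_union_left
    · exact (ihG h).trans Set.subset_union_right
  | mul F G ihF ihG =>
    rcases Finset.mem_union.1 h with h | h
    · obtain ⟨H, hH, rfl⟩ := Finset.mem_image.1 h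
      exact Set.union_subset_union_left _ (ihF hH)
    · exact (ihG h).trans Set.subset_union_right
  | star F ih =>
    obtain ⟨H, hH, rfl⟩ := Finset.mem_image.1 h
    exact Set.union_subset (ih hH) (Set.Subset.refl _)

variable [TopologicalSpace K]

theorem Valid.of_mem_derTer {E H : RatExp K M} (hE : Valid E) (h : H ∈ derTer E) : Valid H := by
  classical
  induction E generalizing H with
  | zero => simp [derTer] at h
  | one => simp [derTer] at h
  | atom m hm =>
    obtain rfl := Finset.mem_singleton.1 h
    trivial
  | lmul k F ih => exact ih hE h
  | rmul F k ih =>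
    obtain ⟨H, hH, rfl⟩ := Finset.mem_image.1 h
    exact (ih hE hH :)
  | add F G ihF ihG =>
    rcases Finset.mem_union.1 h with h | h
    · exact ihF hE.1 h
    · exact ihG hE.2 h
  | mul F G ihF ihG =>
    rcases Finset.mem_union.1 h with h | h
    · obtain ⟨H, hH, rfl⟩ := Finset.mem_image.1 h
      exact ⟨ihF hE.1 hH, hE.2⟩
    · exact ihG hE.2 h
  | star F ih =>
    obtain ⟨H, hH, rfl⟩ := Finset.mem_image.1 h
    exact ⟨ih hE.1 hH, hE⟩

/-- The differential of an expression has its coefficients supported by the atoms. -/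
theorem coeff_deriv_eq_zero {E : RatExp K M} (L : RatExp K M) {m : M} (hm : m ∉ atoms E) :
    (deriv E L).coeff m = 0 := by
  classical
  have hsum : ∀ (T : Finset (RatExp K M)) (x : RatExp K M → MonoidAlgebra K M)
      (p : RatExp K M → Prop), (∀ H, (x H).coeff m = 0) →
      (∑ H ∈ T, if p H then x H else 0).coeff m = 0 := by
    intro T x p hx
    rw [MonoidAlgebra.coeff_sum, Finsupp.finsetSum_apply]
    refine Finset.sum_eq_zero fun H _ => ?_
    split_ifs
    · exact hx H
    · rfl
  induction E generalizing L with
  | zero => rfl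
  | one => rfl
  | atom x hx =>
    have hxm : x ≠ m := fun h => hm h.symm
    rw [deriv]
    split_ifs
    · simp [hxm]
    · rfl
  | lmul k F ih => simp [deriv, ih L hm]
  | rmul F k ih => exact hsum _ _ _ fun H => ih H hm
  | add F G ihF ihG =>
    simp [deriv, ihF L fun h => hm (Or.inl h), ihG L fun h => hm (Or.inr h)]
  | mul F G ihF ihG =>
    rw [deriv, MonoidAlgebra.coeff_add, Finsupp.add_apply,
      hsum _ _ _ fun H => ihF H fun h => hm (Or.inl h)]
    simp [ihG L fun h => hm (Or.inr h)]
  | star F ih =>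
    rw [deriv, MonoidAlgebra.coeff_smul_apply, hsum _ _ _ fun H => ih H hm, smul_zero]

theorem coeff_deriv_one (E L : RatExp K M) : (deriv E L).coeff 1 = 0 :=
  coeff_deriv_eq_zero L fun h => ne_one_of_mem_atoms h rfl

theorem suppIn_coeff_deriv {N : Submonoid M} {E : RatExp K M} (hE : atoms E ⊆ N)
    (L : RatExp K M) : SuppIn N (deriv E L).coeff :=
  fun _ hm => coeff_deriv_eq_zero L fun h => hm (hE h)

section

variable [IsTopologicalSemiring K] [T2Space K] {N : Submonoid M} {len : M → ℕ}

/-- The three claims need one induction: products and powers are defined because of the supports,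
and the star of `series F` exists because `series F 1` is the starrable `constTerm F`. -/
theorem seriesDefined_and_suppIn (hK : IsStrong K) (hlen : ∀ x y, len (x * y) = len x + len y)
    (hlen0 : ∀ x, len x = 0 ↔ x = 1) (hN : FiniteFact N) {E : RatExp K M} (hE : Valid E)
    (hEN : atoms E ⊆ N) :
    SeriesDefined E ∧ SuppIn N (series E) ∧ series E 1 = constTerm E := by
  classical
  induction E with
  | zero => exact ⟨trivial, fun _ _ => rfl, rfl⟩
  | one => exact ⟨trivial, suppIn_monomial (one_mem N) 1, if_pos rfl⟩
  | atom m hm => exact ⟨trivial, suppIn_monomial (hEN rfl) 1, if_neg hm.symm⟩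
  | lmul k F ih =>
    obtain ⟨h1, h2, h3⟩ := ih hE hEN
    exact ⟨h1, fun m hm => by simp [series, h2 m hm], congrArg (k * ·) h3⟩
  | rmul F k ih =>
    obtain ⟨h1, h2, h3⟩ := ih hE hEN
    exact ⟨h1, fun m hm => by simp [series, h2 m hm], congrArg (· * k) h3⟩
  | add F G ihF ihG =>
    obtain ⟨h1, h2, h3⟩ := ihF hE.1 (Set.subset_union_left.trans hEN)
    obtain ⟨h1', h2', h3'⟩ := ihG hE.2 (Set.subset_union_right.trans hEN)
    exact ⟨⟨h1, h1'⟩, fun m hm => by simp [series, h2 m hm, h2' m hm], congrArg₂ (· + ·) h3 h3'⟩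
  | mul F G ihF ihG =>
    obtain ⟨h1, h2, h3⟩ := ihF hE.1 (Set.subset_union_left.trans hEN)
    obtain ⟨h1', h2', h3'⟩ := ihG hE.2 (Set.subset_union_right.trans hEN)
    refine ⟨⟨h1, h1', h2.mulDefined hN h2'⟩, ?_, ?_⟩
    · rw [series, h2.mul_eq hN h2']
      exact suppIn_conv hN _ _
    · rw [series, h2.mul_eq hN h2', conv_apply_one hlen hlen0, h3, h3', constTerm]
  | star F ih =>
    obtain ⟨h1, h2, h3⟩ := ih hE.1 hEN
    have hs : Starrable (series F 1) := h3 ▸ hE.2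
    have hsum := summable_pow hlen hlen0 hK hN h2 hs
    refine ⟨⟨h1, fun n => (suppIn_pow hN h2 n).mulDefined hN h2, hsum⟩, suppIn_star hN h2 hsum, ?_⟩
    rw [series, star_apply hlen hlen0 hK hN h2 hs, constTerm, h3, Finset.sum_eq_zero]
    · simp [monomial]
    · intro p hp
      split_ifs with hp1
      · rfl
      · have := length_lt_of_mem_fact hlen hlen0 hp hp1
        rw [(hlen0 1).2 rfl] at this
        omega

omit [TopologicalSpace K] [IsTopologicalSemiring K] [T2Space K] in
-- Used with `f` the right multiplication by a weight, by `G` or by `F*`, to sum over derived terms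
-- of the operand instead of those of the compound expression.
theorem sum_conv_image (hN : FiniteFact N) (S T : Finset (RatExp K M))
    (x : RatExp K M → MonoidAlgebra K M) (f : RatExp K M → RatExp K M)
    (σ : RatExp K M → Series K M) (hf : ∀ H ∈ S, f H ∈ T) :
    (open Classical in
      ∑ L ∈ T, conv hN (∑ H ∈ S, if f H = L then x H else 0 : MonoidAlgebra K M).coeff (σ L)) =
        ∑ H ∈ S, conv hN (x H).coeff (σ (f H)) := by
  classical
  have h : ∀ L, conv hN (∑ H ∈ S, if f H = L then x H else 0 : MonoidAlgebra K M).coeff (σ L) =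
      ∑ H ∈ S, if f H = L then conv hN (x H).coeff (σ L) else 0 := by
    intro L
    rw [MonoidAlgebra.coeff_sum, Finsupp.coe_finsetSum, conv_sum_left]
    refine Finset.sum_congr rfl fun H _ => ?_
    split_ifs
    · rfl
    · exact conv_zero_left hN _
  simp only [h]
  rw [Finset.sum_comm]
  refine Finset.sum_congr rfl fun H hH => ?_
  rw [Finset.sum_ite_eq, if_pos (hf H hH)]

omit [IsTopologicalSemiring K] [T2Space K] in
theorem sum_conv_deriv (hN : FiniteFact N) {E : RatExp K M} {T : Finset (RatExp K M)}
    (hT : derTer E ⊆ T) (σ : RatExp K M → Series K M) :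
    ∑ L ∈ T, conv hN (deriv E L).coeff (σ L) =
      ∑ L ∈ derTer E, conv hN (deriv E L).coeff (σ L) := by
  refine (Finset.sum_subset hT fun L _ hL => ?_).symm
  rw [deriv_eq_zero hL]
  exact conv_zero_left hN _

/-- The expansion of the series of an expression along its derived terms. -/
theorem series_eq (hK : IsStrong K) (hlen : ∀ x y, len (x * y) = len x + len y)
    (hlen0 : ∀ x, len x = 0 ↔ x = 1) (hN : FiniteFact N) {E : RatExp K M} (hE : Valid E)
    (hEN : atoms E ⊆ N) :
    series E = monomial 1 (constTerm E) +
      ∑ H ∈ derTer E, conv hN (deriv E H).coeff (series H) := by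
  classical
  have supp : ∀ {F : RatExp K M}, Valid F → atoms F ⊆ N → SuppIn N (series F) :=
    fun hF hFN => (seriesDefined_and_suppIn hK hlen hlen0 hN hF hFN).2.1
  have supp' : ∀ {F H : RatExp K M}, Valid F → atoms F ⊆ N → H ∈ derTer F →
      SuppIn N (series H) := fun hF hFN hH =>
    supp (hF.of_mem_derTer hH) ((atoms_subset_of_mem_derTer hH).trans hFN)
  induction E with
  | zero => funext m; simp [series, monomial, constTerm, derTer]
  | one => funext m; simp [series, constTerm, derTer]
  | atom m hm =>
    have h : ((MonoidAlgebra.single m 1 : MonoidAlgebra K M).coeff : Series K M) =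
        monomial m 1 := by
      funext x
      simp [monomial, Finsupp.single_apply, eq_comm (a := x)]
    rw [derTer, Finset.sum_singleton, deriv, if_pos rfl, h, series, series,
      conv_monomial_one_right hN (suppIn_monomial (hEN rfl) 1)]
    funext x
    simp [constTerm, monomial]
  | lmul k F ih =>
    have h : series (lmul k F) = k • series F := rfl
    rw [h, ih hE hEN, smul_add, Finset.smul_sum]
    congr 1
    · funext x
      simp [constTerm, monomial]
    · refine Finset.sum_congr rfl fun H _ => ?_
      rw [← conv_smul_left]
      rfl
  | rmul F k ih =>
    simp only [deriv]
    rw [sum_conv_image hN (derTer F) (derTer (rmul F k)) _ (fun H => rmul H k) series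
      fun H hH => Finset.mem_image_of_mem _ hH]
    simp only [series, conv_mul_right]
    rw [ih hE hEN]
    funext x
    simp [constTerm, monomial, add_mul, Finset.sum_mul]
  | add F G ihF ihG =>
    have h : series (add F G) = series F + series G := rfl
    have hd : ∀ H, ((deriv (add F G) H).coeff : Series K M) =
      (deriv F H).coeff + (deriv G H).coeff := fun H => rfl
    simp only [hd, conv_add_left, Finset.sum_add_distrib]
    have hsF : derTer F ⊆ derTer (add F G) := fun L hL => Finset.mem_union_left _ hL
    have hsG : derTer G ⊆ derTer (add F G) := fun L hL => Finset.mem_union_right _ hL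
    rw [sum_conv_deriv hN hsF, sum_conv_deriv hN hsG, h,
      ihF hE.1 (Set.subset_union_left.trans hEN), ihG hE.2 (Set.subset_union_right.trans hEN)]
    funext x
    by_cases hx : x = 1
    · simp [constTerm, monomial, hx]
      abel
    · simp [constTerm, monomial, hx]
  | mul F G ihF ihG =>
    have hFN := Set.subset_union_left.trans hEN
    have hGN := Set.subset_union_right.trans hEN
    have hG := supp hE.2 hGN
    have hsG : derTer G ⊆ derTer (mul F G) := fun L hL => Finset.mem_union_right _ hL
    have hd : ∀ H, ((deriv (mul F G) H).coeff : Series K M) =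
      (∑ L ∈ derTer F, if mul L G = H then deriv F L else 0 : MonoidAlgebra K M).coeff +
        constTerm F • ((deriv G H).coeff : Series K M) := fun H => rfl
    simp only [hd, conv_add_left, Finset.sum_add_distrib, conv_smul_left]
    rw [sum_conv_image hN (derTer F) (derTer (mul F G)) _ (fun H => mul H G) series
      fun H hH => Finset.mem_union_left _ (Finset.mem_image_of_mem _ hH), ← Finset.smul_sum,
      sum_conv_deriv hN hsG]
    have h1 : ∀ H ∈ derTer F, conv hN (deriv F H).coeff (series (mul H G)) =
        conv hN (conv hN (deriv F H).coeff (series H)) (series G) := fun H hH => by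
      rw [series, (supp' hE.1 hFN hH).mul_eq hN hG, conv_assoc]
    rw [Finset.sum_congr rfl h1, ← conv_sum_left, series,
      (supp hE.1 hFN).mul_eq hN hG]
    nth_rw 1 [ihF hE.1 hFN]
    rw [conv_add_left, conv_monomial_one_left hN hG]
    -- Only the copy of `series G` with coefficient `constTerm F` is expanded; the other one stays
    -- as the right factor coming from the terms `H · G`.
    nth_rw 1 [ihG hE.2 hGN]
    rw [smul_add, add_assoc, add_comm (constTerm F • ∑ H ∈ derTer G, _)]
    congr 1
    funext x
    simp [constTerm, monomial]
  | star F ih =>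
    have hF := seriesDefined_and_suppIn hK hlen hlen0 hN hE.1 hEN
    have hS := supp hE hEN
    have hd : ∀ H, ((deriv (star F) H).coeff : Series K M) = kstar (constTerm F) •
      ((∑ L ∈ derTer F, if mul L (star F) = H then deriv F L else 0 :
        MonoidAlgebra K M).coeff : Series K M) := fun H => rfl
    simp only [hd, conv_smul_left]
    rw [← Finset.smul_sum, sum_conv_image hN (derTer F) (derTer (star F)) _
      (fun H => mul H (star F)) series fun H hH => Finset.mem_image_of_mem _ hH]
    have h1 : ∀ H ∈ derTer F, conv hN (deriv F H).coeff (series (mul H (star F))) =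
        conv hN (conv hN (deriv F H).coeff (series H)) (series (star F)) := fun H hH => by
      rw [series, (supp' hE.1 hEN hH).mul_eq hN hS, conv_assoc]
    rw [Finset.sum_congr rfl h1, ← conv_sum_left]
    funext m
    rw [series, star_apply hlen hlen0 hK hN hF.2.1 (hF.2.2 ▸ hE.2), hF.2.2, mul_add]
    congr 1
    · simp [monomial, constTerm]
    · rw [Pi.smul_apply, smul_eq_mul]
      congr 1
      refine Finset.sum_congr rfl fun p _ => ?_
      -- The sum over the derived terms is the proper part of `series F`: it vanishes at `1` and
      -- agrees with `series F` elsewhere.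
      split_ifs with hp
      · rw [hp, Finset.sum_apply, Finset.sum_eq_zero, zero_mul]
        intro H _
        rw [conv_apply_one hlen hlen0, coeff_deriv_one, zero_mul]
      · congr 1
        nth_rw 1 [ih hE.1 hEN]
        simp [monomial, hp]

/-- The solution of the system assigns `series E` to the initial state and `series H` to the state
`H`; its equations are the expansions of `E` and of its derived terms, in view of
`term_isDifferential`. -/
theorem term_realises_series (hK : IsStrong K) (hlen : ∀ x y, len (x * y) = len x + len y)
    (hlen0 : ∀ x, len x = 0 ↔ x = 1) (hN : FiniteFact N) {E : RatExp K M} (hE : Valid E)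
    (hEN : atoms E ⊆ N) : (term E).toAut.Realises (series E) := by
  have hT := term_isDifferential E
  have hEN' : ∀ H : ↥(derTer E), atoms H.1 ⊆ N := fun H =>
    (atoms_subset_of_mem_derTer H.2).trans hEN
  have hzero : conv hN ((0 : MonoidAlgebra K M).coeff : Series K M) (series E) = 0 :=
    conv_zero_left hN _
  have hmono : ∀ (k : K) (m : M), k * monomial 1 1 m = (monomial 1 k : Series K M) m := by
    intro k m
    simp [monomial]
  refine Aut.realises_of_system hlen hlen0 hN _ ?_ (i := none)
    (term E).toAut_isStandard.1 (term E).toAut_isStandard.2.1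
    (fun p => p.elim (series E) fun H => series H.1) ?_
  · rintro (_ | p) (_ | q)
    · exact fun _ _ => rfl
    · simpa [StdAut.toAut, hT.J_eq] using suppIn_coeff_deriv hEN q.1
    · exact fun _ _ => rfl
    · simpa [StdAut.toAut, hT.F_eq] using suppIn_coeff_deriv (hEN' p) q.1
  · rintro (_ | p) m
    · rw [Fintype.sum_option]
      simp only [StdAut.toAut, Matrix.of_apply, Option.elim, hT.J_eq, hT.c_eq, hzero, hmono]
      rw [Finset.sum_coe_sort (derTer E) fun L => conv hN (deriv E L).coeff (series L) m]
      conv_lhs => rw [series_eq hK hlen hlen0 hN hE hEN]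
      simp
    · rw [Fintype.sum_option]
      simp only [StdAut.toAut, Matrix.of_apply, Option.elim, hT.F_eq, hT.U_eq, hzero, hmono]
      rw [Finset.sum_coe_sort (derTer E) fun L => conv hN (deriv p.1 L).coeff (series L) m]
      conv_lhs => rw [series_eq hK hlen hlen0 hN (hE.of_mem_derTer p.2) (hEN' p)]
      -- The expansion of the state runs over its own derived terms, the system over all those of
      -- `E`; the extra terms vanish.
      rw [← sum_conv_deriv hN (derTer_subset p.2)]
      simp

end

end RatExp

end WRat

end

theorem theoremt {K : Type*} {M : Type*} [Semiring K] [TopologicalSpace K]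
    [IsTopologicalSemiring K] [T2Space K] (hK : WRat.IsStrong K)
    [Monoid M] (hM : WRat.IsGraded M)
    (E : WRat.RatExp K M) (hE : E.Valid) :
    -- the construction makes sense: the natural maps by which it merges states are morphisms
    (∀ F G : WRat.RatExp K M, E = .add F G →
      WRat.Aut.IsMorphism (F.term.add G.term).toAut (F.add G).term.toAut
        (Option.map (WRat.RatExp.addMap F G))) ∧
    (∀ F G : WRat.RatExp K M, E = .mul F G →
      WRat.Aut.IsMorphism (F.term.mul G.term).toAut (F.mul G).term.toAut
        (Option.map (WRat.RatExp.mulMap F G))) ∧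
    -- it yields a standard automaton, which realises the series denoted by `E`
    E.term.toAut.IsStandard none ∧
    E.SeriesDefined ∧ E.term.toAut.Realises E.series ∧
    -- and which is a quotient of the standard automaton of `E`
    WRat.Aut.IsQuotient E.term.toAut E.stan.toAut := by
  obtain ⟨len, hlen, hlen0⟩ := hM
  -- The atoms of `E` are finite in number and, being different from `1`, of positive length.
  have hN : WRat.FiniteFact (Submonoid.closure E.atoms) :=
    WRat.finiteFact_closure hlen E.finite_atoms fun a ha h =>
      WRat.RatExp.ne_one_of_mem_atoms ha ((hlen0 a).1 h)
  have hEN : E.atoms ⊆ Submonoid.closure E.atoms := Submonoid.subset_closure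
  refine ⟨fun F G _ => ?_, fun F G _ => ?_, E.term.toAut_isStandard,
    (WRat.RatExp.seriesDefined_and_suppIn hK hlen hlen0 hN hE hEN).1,
    WRat.RatExp.term_realises_series hK hlen hlen0 hN hE hEN, ?_⟩
  · exact ((WRat.RatExp.term_isDifferential F).isMor_add
      (WRat.RatExp.term_isDifferential G)).isMorphism (WRat.RatExp.addMap_surjective F G)
  · exact ((WRat.RatExp.term_isDifferential F).isMor_mul
      (WRat.RatExp.term_isDifferential G)).isMorphism (WRat.RatExp.mulMap_surjective F G)
  · obtain ⟨φ, hφ, h⟩ := E.exists_isMor_stan_term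
    exact ⟨_, h.isMorphism hφ⟩
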